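/- Let $K$ be a field and let $R=\bigoplus_{j\ge 0}R_j$ be a standard graded $K$-algebra (commutative, $R_0=K$, and $R$ is generated as a $K$-algebra by the finite-dimensional space $R_1$) with maximal homogeneous ideal $\mathfrak m=\bigoplus_{j>0}R_j$. For a finitely generated graded $R$-module $M$ put $t_i^R(M)=\max\{j:\operatorname{Tor}_i^R(M,K)_j\ne 0\}$ (with $t_i^R(M)=-\infty$ if $\operatorname{Tor}_i^R(M,K)=0$) and $\operatorname{reg}_R(M)=\sup_{i\ge 0}\{t_i^R(M)-i\}$. Assume that $R$ is a Koszul algebra, i.e. $\operatorname{reg}_R(K)=0$. Let $c,t\ge 0$ be integers and assume that $\operatorname{char}K=0$ or $\operatorname{char}K>t$. Let $u_1,\dots,u_n$ be a minimal system of homogeneous generators of $\mathfrak m^c$, let $F=\bigoplus_{a=1}^n R(-\deg u_a)$ with basis $e_1,\dots,e_n$, and let $\phi:F\to R$ be the $R$-linear map with $\phi(e_a)=u_a$ (so $\operatorname{Im}\phi=\mathfrak m^c$ and $\ker\phi\subseteq\mathfrak mF$). Let $Z_t\subseteq\bigwedge^tF$ be the graded module of cycles of homological degree $t$ of the Koszul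 complex $(\bigwedge^\bullet F,\phi)$, and let $Z_1^t\subseteq Z_t$ be the image of the canonical map $\bigwedge^tZ_1\to Z_t$ (so $Z_1^0=R=Z_0$). Then the graded module $Z_t/Z_1^t$ vanishes in all degrees $j\ge t(c+1)$. Moreover $Z_1^t$ has an $R$-linear resolution with generators in degree $t(c+1)$: there is an exact sequence of graded $R$-modules with maps of degree $0$ $$\cdots\to F_2\to F_1\to F_0\to Z_1^t\to 0$$ in which each $F_i$ is a finite direct sum (possibly empty) of copies of $R(-t(c+1)-i)$. -/

import Mathlib

namespace KoszulCycles

section Graded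

variable {K R : Type*} [Field K] [CommRing R] [Algebra K R]

/-- A (nonzero) ring `R` is a standard graded algebra over a field `K`: the component of degree `0`
is `K`, the component of degree `1` is finite dimensional, and it generates the algebra. -/
structure IsStandardGraded (𝒜 : ℕ → Submodule K R) [GradedAlgebra 𝒜] : Prop where
  zero_eq : 𝒜 0 = 1
  finite_one : Module.Finite K (𝒜 1)
  adjoin_one : Algebra.adjoin K (𝒜 1 : Set R) = ⊤

/-- The maximal homogeneous ideal `𝔪`, the sum of the components of positive degree. -/
def maxIdeal (𝒜 : ℕ → Submodule K R) [GradedAlgebra 𝒜] : Ideal R :=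
  (HomogeneousIdeal.irrelevant 𝒜).toIdeal

/-- The component of degree `j` of the graded free module `⨁ₐ R(-s a)`. -/
def freePiece (𝒜 : ℕ → Submodule K R) {n : ℕ} (s : Fin n → ℕ) (j : ℕ) :
    Submodule K (Fin n → R) :=
  Submodule.pi Set.univ fun a => if s a ≤ j then 𝒜 (j - s a) else ⊥

/-- A graded resolution of `M` by finitely generated graded free `R`-modules
`F i = ⨁ₐ R(-shift i a)`, with maps homogeneous of degree `0`. Here `M` is an `R`-module whose
homogeneous components are the subspaces `ℳ j`. -/
structure GradedFreeResolution (𝒜 : ℕ → Submodule K R) {M : Type*} [AddCommGroup M] [Module R M]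
    [Module K M] (ℳ : ℕ → Submodule K M) where
  /-- the rank of `F i` -/
  rank : ℕ → ℕ
  /-- the degrees of the basis elements of `F i` -/
  shift : ∀ i, Fin (rank i) → ℕ
  /-- the augmentation `F 0 → M` -/
  aug : (Fin (rank 0) → R) →ₗ[R] M
  /-- the differential `F (i + 1) → F i` -/
  d : ∀ i, (Fin (rank (i + 1)) → R) →ₗ[R] (Fin (rank i) → R)
  aug_mem : ∀ a, aug (Pi.single a 1) ∈ ℳ (shift 0 a)
  d_mem : ∀ i a, d i (Pi.single a 1) ∈ freePiece 𝒜 (shift i) (shift (i + 1) a)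
  aug_surjective : Function.Surjective aug
  exact_zero : Function.Exact (d 0) aug
  exact_succ : ∀ i, Function.Exact (d (i + 1)) (d i)

namespace GradedFreeResolution

variable {𝒜 : ℕ → Submodule K R} [GradedAlgebra 𝒜] {M : Type*} [AddCommGroup M] [Module R M]
  [Module K M] {ℳ : ℕ → Submodule K M}

/-- The preimage in `F i` of the cycles of `F ⊗ R/𝔪 = F / 𝔪 F` in homological degree `i`. -/
def torCycles (F : GradedFreeResolution 𝒜 ℳ) : ∀ i, Submodule R (Fin (F.rank i) → R)
  | 0 => ⊤
  | i + 1 => (maxIdeal 𝒜 • (⊤ : Submodule R (Fin (F.rank i) → R))).comap (F.d i)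

/-- The preimage in `F i` of the boundaries of `F ⊗ R/𝔪 = F / 𝔪 F` in homological degree `i`. -/
def torBoundaries (F : GradedFreeResolution 𝒜 ℳ) (i : ℕ) : Submodule R (Fin (F.rank i) → R) :=
  LinearMap.range (F.d i) ⊔ maxIdeal 𝒜 • (⊤ : Submodule R (Fin (F.rank i) → R))

/-- The component of degree `j` of `Tor_i(M, R/𝔪) = H_i(F ⊗ R/𝔪)`, as a subspace of
`F i` modulo (the preimage of) the boundaries. -/
def torPiece (F : GradedFreeResolution 𝒜 ℳ) (i j : ℕ) :
    Submodule K ((Fin (F.rank i) → R) ⧸ F.torBoundaries i) :=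
  ((F.torCycles i).restrictScalars K ⊓ freePiece 𝒜 (F.shift i) j).map
    ((F.torBoundaries i).mkQ.restrictScalars K)

end GradedFreeResolution

section Regularity

variable (𝒜 : ℕ → Submodule K R) [GradedAlgebra 𝒜] {M : Type*} [AddCommGroup M] [Module R M]
  [Module K M] (ℳ : ℕ → Submodule K M)

/-- The graded Betti number `dim_K Tor_i(M, K)_j` is nonzero. (`Tor` does not depend on the
graded free resolution from which it is computed.) -/
def TorNonzero (i j : ℕ) : Prop :=
  ∃ F : GradedFreeResolution 𝒜 ℳ, F.torPiece i j ≠ ⊥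

/-- `t_i(M)`, the largest degree in which `Tor_i(M, K)` is nonzero (`-∞` if there is none). -/
noncomputable def topDegree (i : ℕ) : EReal :=
  sSup ((fun j : ℕ => (j : EReal)) '' {j | TorNonzero 𝒜 ℳ i j})

/-- The Castelnuovo-Mumford regularity of `M` over `R`, the supremum of `t_i(M) - i`. -/
noncomputable def reg : EReal :=
  ⨆ i : ℕ, topDegree 𝒜 ℳ i - (i : EReal)

/-- The residue field `R/𝔪` as a graded `R`-module. -/
def residueGrading (j : ℕ) : Submodule K (R ⧸ maxIdeal 𝒜) :=
  (𝒜 j).map (Ideal.Quotient.mkₐ K (maxIdeal 𝒜)).toLinearMap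

/-- A Koszul algebra: the residue field has regularity `0`. -/
def IsKoszul : Prop := reg 𝒜 (residueGrading 𝒜) = 0

/-- `M` has an `R`-linear resolution, with generators in degree `d`: there is a graded free
resolution whose `i`-th module is a direct sum of copies of `R(-d-i)`. -/
def HasLinearResolution (d : ℕ) : Prop :=
  ∃ F : GradedFreeResolution 𝒜 ℳ, ∀ i a, F.shift i a = d + i

end Regularity

end Graded

section Koszul

variable {K R : Type*} [Field K] [CommRing R] [Algebra K R] {n : ℕ}

/-- The map `φ : R^n → R` with `φ (e_a) = u a`. -/
noncomputable def koszulForm (u : Fin n → R) : (Fin n → R) →ₗ[R] R :=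
  Fintype.linearCombination R u

/-- The homogeneous elements `u a` (of degree `deg a`) generate the ideal `I` minimally:
`φ : ⨁ₐ R(-deg a) → R` has image `I`, and its kernel is contained in `𝔪 (⨁ₐ R(-deg a))`. -/
structure IsMinimalGenerators (𝒜 : ℕ → Submodule K R) [GradedAlgebra 𝒜] (I : Ideal R)
    (deg : Fin n → ℕ) (u : Fin n → R) : Prop where
  mem : ∀ a, u a ∈ 𝒜 (deg a)
  range_eq : LinearMap.range (koszulForm u) = I
  ker_le : LinearMap.ker (koszulForm u) ≤ maxIdeal 𝒜 • (⊤ : Submodule R (Fin n → R))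

/-- The differential of the Koszul complex `⋀ R^n` of `φ`: the antiderivation of the exterior
algebra extending `φ`, i.e. the contraction with the linear form `φ`. -/
noncomputable def koszulDifferential (u : Fin n → R) :
    ExteriorAlgebra R (Fin n → R) →ₗ[R] ExteriorAlgebra R (Fin n → R) :=
  CliffordAlgebra.contractLeft (Q := (0 : QuadraticForm R (Fin n → R))) (koszulForm u)

/-- The Koszul cycles `Z_t` of homological degree `t`. -/
noncomputable def cycles (u : Fin n → R) (t : ℕ) : Submodule R (ExteriorAlgebra R (Fin n → R)) :=
  ⋀[R]^t (Fin n → R) ⊓ LinearMap.ker (koszulDifferential u)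

/-- `Z_1^t`, the submodule generated by the products `z_1 ∧ ⋯ ∧ z_t` with `z_i ∈ Z_1`, that is,
the image of `⋀^t Z_1`; for `t = 0` it is `R`. -/
noncomputable def cyclesPow (u : Fin n → R) (t : ℕ) :
    Submodule R (ExteriorAlgebra R (Fin n → R)) :=
  cycles u 1 ^ t

theorem cyclesPow_le (u : Fin n → R) (t : ℕ) : cyclesPow u t ≤ cycles u t := by
  induction t with
  | zero =>
    rw [cyclesPow, pow_zero, Submodule.one_le]
    refine ⟨?_, ?_⟩
    · rw [SetLike.mem_coe, ExteriorAlgebra.exteriorPower, pow_zero]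
      exact Submodule.one_le.mp le_rfl
    · exact CliffordAlgebra.contractLeft_one (Q := (0 : QuadraticForm R (Fin n → R))) _
  | succ t ih =>
    rw [cyclesPow, pow_succ', Submodule.mul_le]
    intro z hz y hy
    have hy' := ih hy
    obtain ⟨hz1, hz2⟩ := hz
    refine ⟨?_, ?_⟩
    · rw [SetLike.mem_coe, ExteriorAlgebra.exteriorPower, pow_succ']
      refine Submodule.mul_mem_mul ?_ hy'.1
      simpa [ExteriorAlgebra.exteriorPower] using hz1
    · have hz1' : z ∈ LinearMap.range (ExteriorAlgebra.ι R : (Fin n → R) →ₗ[R] _) := by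
        simpa [ExteriorAlgebra.exteriorPower] using hz1
      obtain ⟨v, rfl⟩ := hz1'
      have h1 : koszulDifferential u (ExteriorAlgebra.ι R v) = 0 := hz2
      have h2 : koszulDifferential u y = 0 := hy'.2
      have h3 : koszulDifferential u (ExteriorAlgebra.ι R v)
          = algebraMap R _ (koszulForm u v) :=
        CliffordAlgebra.contractLeft_ι (Q := (0 : QuadraticForm R (Fin n → R))) _ v
      have h4 : koszulDifferential u (ExteriorAlgebra.ι R v * y)
          = koszulForm u v • y - ExteriorAlgebra.ι R v * koszulDifferential u y :=
        CliffordAlgebra.contractLeft_ι_mul (Q := (0 : QuadraticForm R (Fin n → R))) _ v y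
      change koszulDifferential u (ExteriorAlgebra.ι R v * y) = 0
      rw [h4, h2, mul_zero, sub_zero, Algebra.smul_def, ← h3, h1, zero_mul]

/-- The component of internal degree `j` of `K_t = ⋀^t (⨁ₐ R(-deg a))`: it is spanned over `K` by
the elements `r • e_{v 0} ∧ ⋯ ∧ e_{v (t-1)}` with `r` homogeneous and
`deg r + deg (v 0) + ⋯ + deg (v (t-1)) = j`. -/
noncomputable def koszulPiece (𝒜 : ℕ → Submodule K R) (deg : Fin n → ℕ) (t j : ℕ) :
    Submodule K (ExteriorAlgebra R (Fin n → R)) :=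
  Submodule.span K {x | ∃ (p : ℕ) (r : R) (v : Fin t → Fin n), r ∈ 𝒜 p ∧
    p + ∑ k, deg (v k) = j ∧
    x = r • ExteriorAlgebra.ιMulti R t (fun k => (Pi.single (v k) 1 : Fin n → R))}

/-- The grading induced on a submodule `N` of `K_t`. -/
noncomputable def inducedGrading (𝒜 : ℕ → Submodule K R) (deg : Fin n → ℕ) (t : ℕ)
    (N : Submodule R (ExteriorAlgebra R (Fin n → R))) (j : ℕ) : Submodule K N :=
  (koszulPiece 𝒜 deg t j).comap (N.subtype.restrictScalars K)

/-- The submodule `Z_1^t` of the module `Z_t`. -/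
noncomputable def cyclesPowIn (u : Fin n → R) (t : ℕ) : Submodule R (cycles u t) :=
  (cyclesPow u t).comap (cycles u t).subtype

/-- The component of degree `j` of the graded module `Z_t / Z_1^t`. -/
noncomputable def quotientPiece (𝒜 : ℕ → Submodule K R) (deg : Fin n → ℕ) (u : Fin n → R)
    (t j : ℕ) : Submodule K (cycles u t ⧸ cyclesPowIn u t) :=
  (inducedGrading 𝒜 deg t (cycles u t) j).map ((cyclesPowIn u t).mkQ.restrictScalars K)

end Koszul

end KoszulCycles

/-! Let T_t be the part of Z_t in internal degrees at least t(c+1) (`truncCycles`). An induction on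
t proves two statements together (`truncCycles_eq_cyclesPow`): T_t = Z_1^t, and reg T_t ≤ t(c+1).
The equality is the vanishing of Z_t/Z_1^t in degrees at least t(c+1). Since T_t has no elements of
smaller degree, the regularity bound makes its resolution linear (`hasLinearResolution_of_regLE`).

For the step from t to t+1, note that all u_a have degree c (`IsMinimalGenerators.deg_eq`). Let ∂_a
be the contraction with the a-th coordinate form. The Koszul differential is Σ u_a ∂_a and
anticommutes with every ∂_a, so z ↦ (∂_a z)_a maps T_{t+1} into the relations Σ u_a z_a = 0 on T_t.
Euler's formula Σ e_a ∧ ∂_a z = (t+1) z (`sum_extGen_mul_extContract`) provides a left inverse,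
because t+1 is invertible in K. Thus T_{t+1} is a direct summand of the module of relations of
degree at least (t+1)(c+1).

With M = T_t and d = t(c+1), the regularity of that module is read off from 0 → ker → M(-c)^n →
M_{≥d+c} → 0 (`RegLE.relations`). This is where Koszulness enters: K(-e) has regularity at most e,
so reg M ≤ d implies reg M_{≥d+c} ≤ d+c (`RegLE.trunc_add`).

For the equality, linearity of the presentation of M shows that a relation with all z_a in degrees
above d comes from Z_1 ⊗ M (`mem_span_of_relation`). Hence ∂_a z = Σ_b w_b(a) y_b with w_b in Z_1
and y_b in T_t = Z_1^t, and (t+1) z = Σ_b w_b ∧ y_b lies in Z_1^{t+1}.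

Regularity is handled through `RegLE`, the existence of possibly nonminimal free resolutions with
bounded degrees. Its behaviour in short exact sequences is proved by constructing resolutions, so no
long exact sequence of Tor is needed. Tor appears only where the Koszul hypothesis is turned into a
bound for 𝔪 (`IsKoszul.regLE_maxIdeal`). -/

namespace KoszulCycles

universe w u

/-! ### Graded modules described by their projections, and homogeneous maps -/

section ModuleGradings

variable {K : Type w} {R : Type u} [Field K] [CommRing R] [Algebra K R]

/-- A grading of the `R`-module `M` compatible with the grading `𝒜` of `R`, given by the family of
projections onto the homogeneous components. -/
structure ModuleGrading (𝒜 : ℕ → Submodule K R) (M : Type u) [AddCommGroup M] [Module R M] where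
  /-- the projection to the component of degree `i` -/
  proj : ℕ → M →+ M
  proj_proj : ∀ i j x, proj i (proj j x) = if i = j then proj j x else 0
  eq_zero : ∀ x, (∀ i, proj i x = 0) → x = 0
  bounded : ∀ x, ∃ N, ∀ i, N ≤ i → proj i x = 0
  smul_mem : ∀ i r, r ∈ 𝒜 i → ∀ l x, proj l x = x → proj (i + l) (r • x) = r • x

variable {𝒜 : ℕ → Submodule K R} {M M' M'' : Type u} [AddCommGroup M] [Module R M]
  [AddCommGroup M'] [Module R M'] [AddCommGroup M''] [Module R M'']

namespace ModuleGrading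

variable (g : ModuleGrading 𝒜 M)

theorem proj_self (i : ℕ) (x : M) : g.proj i (g.proj i x) = g.proj i x := by
  rw [proj_proj, if_pos rfl]

theorem proj_of_ne {i j : ℕ} (h : i ≠ j) (x : M) : g.proj i (g.proj j x) = 0 := by
  rw [proj_proj, if_neg h]

theorem proj_eq_zero_of_ne {i j : ℕ} (h : i ≠ j) {x : M} (hx : g.proj j x = x) :
    g.proj i x = 0 := by
  rw [← hx, g.proj_of_ne h]

theorem ext_proj {x y : M} (h : ∀ i, g.proj i x = g.proj i y) : x = y :=
  sub_eq_zero.mp (g.eq_zero _ fun i => by rw [map_sub, h, sub_self])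

theorem sum_proj (x : M) : ∃ N, ∑ i ∈ Finset.range N, g.proj i x = x := by
  obtain ⟨N, hN⟩ := g.bounded x
  refine ⟨N, g.ext_proj fun j => ?_⟩
  simp only [map_sum, proj_proj, Finset.sum_ite_eq, Finset.mem_range]
  split_ifs with h
  · rfl
  · exact (hN j (not_lt.mp h)).symm

theorem mem_of_proj_mem (N : Submodule R M) {x : M} (h : ∀ i, g.proj i x ∈ N) : x ∈ N := by
  obtain ⟨n, hn⟩ := g.sum_proj x
  rw [← hn]
  exact N.sum_mem fun i _ => h i

theorem proj_smul_mem {i : ℕ} {r : R} (hr : r ∈ 𝒜 i) (j : ℕ) (x : M) :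
    g.proj j (r • x) = if i ≤ j then r • g.proj (j - i) x else 0 := by
  obtain ⟨n, hn⟩ := g.bounded x
  obtain ⟨N, hN⟩ := g.sum_proj x
  conv_lhs => rw [← hN, Finset.smul_sum, map_sum]
  have h1 : ∀ l, g.proj j (r • g.proj l x) = if j = i + l then r • g.proj l x else 0 := by
    intro l
    rw [← g.smul_mem i r hr l (g.proj l x) (g.proj_self l x), proj_proj]
  simp only [h1]
  split_ifs with hij
  · obtain ⟨l, rfl⟩ := Nat.exists_eq_add_of_le hij
    simp only [add_right_inj, Finset.sum_ite_eq, Nat.add_sub_cancel_left, Finset.mem_range]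
    split_ifs with hl
    · rfl
    · have : g.proj l x = 0 := by
        rw [← hN, map_sum]
        refine Finset.sum_eq_zero fun a ha => g.proj_of_ne ?_ x
        rintro rfl
        exact hl (Finset.mem_range.mp ha)
      rw [this, smul_zero]
  · exact Finset.sum_eq_zero fun l _ => if_neg (by omega)

variable [GradedAlgebra 𝒜]

theorem proj_smul_homogeneous {l : ℕ} {x : M} (hx : g.proj l x = x) (j : ℕ) (r : R) :
    g.proj j (r • x) = if l ≤ j then GradedRing.proj 𝒜 (j - l) r • x else 0 := by
  classical
  have hr := DirectSum.sum_support_decompose 𝒜 r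
  conv_lhs => rw [← hr, Finset.sum_smul, map_sum]
  have h1 : ∀ i, g.proj j ((DirectSum.decompose 𝒜 r i : R) • x) =
      if j = i + l then (DirectSum.decompose 𝒜 r i : R) • x else 0 := by
    intro i
    rw [g.proj_smul_mem (SetLike.coe_mem _)]
    by_cases h : j = i + l
    · subst h
      simp [hx]
    · rw [if_neg h]
      split_ifs with h2
      · rw [g.proj_eq_zero_of_ne (by omega) hx, smul_zero]
      · rfl
  simp only [h1]
  split_ifs with hl
  · obtain ⟨i, rfl⟩ := Nat.exists_eq_add_of_le' hl
    simp only [add_left_inj, Finset.sum_ite_eq, Nat.add_sub_cancel, GradedRing.proj_apply]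
    split_ifs with hi
    · rfl
    · rw [DFinsupp.notMem_support_iff.mp hi, ZeroMemClass.coe_zero, zero_smul]
  · exact Finset.sum_eq_zero fun i _ => if_neg (by omega)

theorem proj_smul_eq_zero {N : ℕ} {x : M} (h : ∀ j < N, g.proj j x = 0) (r : R) :
    ∀ j < N, g.proj j (r • x) = 0 := by
  classical
  intro j hj
  rw [← DirectSum.sum_support_decompose 𝒜 r, Finset.sum_smul, map_sum]
  refine Finset.sum_eq_zero fun i _ => ?_
  rw [g.proj_smul_mem (SetLike.coe_mem _)]
  split_ifs
  · rw [h _ (by omega), smul_zero]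
  · rfl

/-- The submodule of elements whose components of degree less than `N` vanish. -/
def trunc (N : ℕ) : Submodule R M where
  carrier := {x | ∀ j < N, g.proj j x = 0}
  zero_mem' := fun j _ => map_zero _
  add_mem' := fun hx hy j hj => by rw [map_add, hx j hj, hy j hj, add_zero]
  smul_mem' := fun r _ hx => g.proj_smul_eq_zero hx r

theorem mem_trunc_of_homogeneous {N j : ℕ} {x : M} (hx : g.proj j x = x) (h : N ≤ j) :
    x ∈ g.trunc N := fun i hi => g.proj_eq_zero_of_ne (by omega) hx

end ModuleGrading

/-- A submodule is homogeneous if it is stable under the projections. -/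
def ModuleGrading.Homogeneous (g : ModuleGrading 𝒜 M) (N : Submodule R M) : Prop :=
  ∀ i, ∀ x ∈ N, g.proj i x ∈ N

namespace ModuleGrading

theorem homogeneous_trunc [GradedAlgebra 𝒜] (g : ModuleGrading 𝒜 M) (N : ℕ) :
    g.Homogeneous (g.trunc N) := fun i x hx j hj => by
  rw [proj_proj]
  split_ifs with h
  · exact h ▸ hx j hj
  · rfl

/-- The grading induced on a homogeneous submodule. -/
def sub (g : ModuleGrading 𝒜 M) (N : Submodule R M) (hN : g.Homogeneous N) :
    ModuleGrading 𝒜 N where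
  proj i :=
    { toFun := fun x => ⟨g.proj i x, hN i x x.2⟩
      map_zero' := Subtype.ext (map_zero _)
      map_add' := fun x y => Subtype.ext (map_add _ _ _) }
  proj_proj i j x := by
    apply Subtype.ext
    change g.proj i (g.proj j x) = _
    rw [proj_proj]
    split_ifs <;> rfl
  eq_zero x h := Subtype.ext (g.eq_zero x fun i => congrArg Subtype.val (h i))
  bounded x := (g.bounded x).imp fun n hn i hi => Subtype.ext (hn i hi)
  smul_mem i r hr l x hx := Subtype.ext (g.smul_mem i r hr l x (congrArg Subtype.val hx))

@[simp]
theorem coe_sub_proj (g : ModuleGrading 𝒜 M) (N : Submodule R M) (hN : g.Homogeneous N) (i : ℕ)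
    (x : N) : ((g.sub N hN).proj i x : M) = g.proj i x := rfl

/-- The grading induced on the quotient by a homogeneous submodule. -/
def quot (g : ModuleGrading 𝒜 M) (N : Submodule R M) (hN : g.Homogeneous N) :
    ModuleGrading 𝒜 (M ⧸ N) where
  proj i := QuotientAddGroup.map N.toAddSubgroup N.toAddSubgroup (g.proj i) fun x hx => hN i x hx
  proj_proj i j x := by
    induction x using Submodule.Quotient.induction_on with | _ x =>
    change Submodule.Quotient.mk (g.proj i (g.proj j x)) = _
    rw [proj_proj]
    split_ifs <;> rfl
  eq_zero x h := by
    induction x using Submodule.Quotient.induction_on with | _ x =>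
    exact (Submodule.Quotient.mk_eq_zero N).mpr
      (g.mem_of_proj_mem N fun i => (Submodule.Quotient.mk_eq_zero N).mp (h i))
  bounded x := by
    induction x using Submodule.Quotient.induction_on with | _ x =>
    refine (g.bounded x).imp fun n hn i hi => ?_
    change Submodule.Quotient.mk (g.proj i x) = _
    rw [hn i hi]
    rfl
  smul_mem i r hr l x hx := by
    induction x using Submodule.Quotient.induction_on with | _ x =>
    have h : Submodule.Quotient.mk (g.proj l x) = (Submodule.Quotient.mk x : M ⧸ N) := hx
    rw [← h]
    change Submodule.Quotient.mk (g.proj (i + l) (r • g.proj l x)) = _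
    rw [g.smul_mem i r hr l _ (g.proj_self l x)]
    rfl

/-- The graded module `⨁ₐ M(-s a)`. -/
def pi (g : ModuleGrading 𝒜 M) {ι : Type} [Fintype ι] (s : ι → ℕ) : ModuleGrading 𝒜 (ι → M) where
  proj j :=
    { toFun := fun x a => if s a ≤ j then g.proj (j - s a) (x a) else 0
      map_zero' := by ext a; simp
      map_add' := fun x y => by
        ext a
        simp only [Pi.add_apply, map_add]
        split_ifs <;> simp }
  proj_proj i j x := by
    ext a
    change (if s a ≤ i then g.proj (i - s a) (if s a ≤ j then g.proj (j - s a) (x a) else 0)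
      else 0) = _
    by_cases hij : i = j
    · subst hij
      rw [if_pos rfl]
      change _ = if s a ≤ i then g.proj (i - s a) (x a) else 0
      split_ifs
      · rw [proj_self]
      · rfl
    · rw [if_neg hij]
      split_ifs
      · exact g.proj_of_ne (by omega) _
      · exact map_zero _
      · rfl
  eq_zero x h := by
    ext a
    refine g.eq_zero _ fun i => ?_
    have := congrFun (h (i + s a)) a
    change (if s a ≤ i + s a then g.proj (i + s a - s a) (x a) else 0) = 0 at this
    simpa using this
  bounded x := by
    choose N hN using fun a => g.bounded (x a)
    refine ⟨∑ a, (N a + s a), fun i hi => ?_⟩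
    ext a
    change (if s a ≤ i then g.proj (i - s a) (x a) else 0) = 0
    have : N a + s a ≤ ∑ a, (N a + s a) :=
      Finset.single_le_sum (f := fun a => N a + s a) (fun _ _ => Nat.zero_le _) (Finset.mem_univ a)
    rw [if_pos (by omega), hN a _ (by omega)]
  smul_mem i r hr l x hx := by
    ext a
    have := congrFun hx a
    change (if s a ≤ l then g.proj (l - s a) (x a) else 0) = x a at this
    change (if s a ≤ i + l then g.proj (i + l - s a) (r • x a) else 0) = r • x a
    by_cases h : s a ≤ l
    · rw [if_pos h] at this
      rw [if_pos (by omega), Nat.add_sub_assoc h, g.smul_mem i r hr _ _ this]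
    · rw [if_neg h] at this
      rw [← this, smul_zero, map_zero, ite_self]

theorem pi_proj_apply (g : ModuleGrading 𝒜 M) {ι : Type} [Fintype ι] (s : ι → ℕ) (j : ℕ)
    (x : ι → M) (a : ι) :
    (g.pi s).proj j x a = if s a ≤ j then g.proj (j - s a) (x a) else 0 := rfl

/-- The grading of a product. -/
def prod (g : ModuleGrading 𝒜 M) (g' : ModuleGrading 𝒜 M') : ModuleGrading 𝒜 (M × M') where
  proj j := (g.proj j).prodMap (g'.proj j)
  proj_proj i j x := by
    change (g.proj i (g.proj j x.1), g'.proj i (g'.proj j x.2)) = _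
    rw [proj_proj, proj_proj]
    split_ifs <;> rfl
  eq_zero x h := Prod.ext (g.eq_zero _ fun i => congrArg Prod.fst (h i))
    (g'.eq_zero _ fun i => congrArg Prod.snd (h i))
  bounded x := by
    obtain ⟨n, hn⟩ := g.bounded x.1
    obtain ⟨n', hn'⟩ := g'.bounded x.2
    exact ⟨n + n', fun i hi => Prod.ext (hn i (by omega)) (hn' i (by omega))⟩
  smul_mem i r hr l x hx := Prod.ext (g.smul_mem i r hr l _ (congrArg Prod.fst hx))
    (g'.smul_mem i r hr l _ (congrArg Prod.snd hx))

theorem prod_proj (g : ModuleGrading 𝒜 M) (g' : ModuleGrading 𝒜 M') (j : ℕ) (x : M × M') :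
    (g.prod g').proj j x = (g.proj j x.1, g'.proj j x.2) := rfl

/-- Transport of a grading along a linear equivalence. -/
def comapEquiv (g' : ModuleGrading 𝒜 M') (e : M ≃ₗ[R] M') : ModuleGrading 𝒜 M where
  proj j := (e.symm : M' →+ M).comp ((g'.proj j).comp (e : M →+ M'))
  proj_proj i j x := by
    change e.symm (g'.proj i (e (e.symm (g'.proj j (e x))))) = if i = j then e.symm _ else 0
    rw [LinearEquiv.apply_symm_apply, proj_proj]
    split_ifs
    · rfl
    · exact map_zero _
  eq_zero x h := by
    have : e x = 0 := g'.eq_zero _ fun i => by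
      have h1 : e.symm (g'.proj i (e x)) = 0 := h i
      simpa using h1
    simpa using this
  bounded x := (g'.bounded (e x)).imp fun n hn i hi => by
    change e.symm (g'.proj i (e x)) = 0
    rw [hn i hi, map_zero]
  smul_mem i r hr l x hx := by
    have h1 : e.symm (g'.proj l (e x)) = x := hx
    have h2 : g'.proj l (e x) = e x := e.symm_apply_eq.mp h1
    change e.symm (g'.proj (i + l) (e (r • x))) = r • x
    rw [map_smul, g'.smul_mem i r hr l _ h2, map_smul, LinearEquiv.symm_apply_apply]

theorem comapEquiv_proj (g' : ModuleGrading 𝒜 M') (e : M ≃ₗ[R] M') (j : ℕ) (x : M) :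
    (g'.comapEquiv e).proj j x = e.symm (g'.proj j (e x)) := rfl

/-- The grading of `R` as a module over itself. -/
def self (𝒜 : ℕ → Submodule K R) [GradedAlgebra 𝒜] : ModuleGrading 𝒜 R where
  proj := GradedRing.proj 𝒜
  proj_proj i j x := by
    simp only [GradedRing.proj_apply]
    split_ifs with h
    · subst h
      exact DirectSum.decompose_of_mem_same 𝒜 (SetLike.coe_mem _)
    · exact DirectSum.decompose_of_mem_ne 𝒜 (SetLike.coe_mem _) (Ne.symm h)
  eq_zero x h := by
    classical
    rw [← DirectSum.sum_support_decompose 𝒜 x]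
    exact Finset.sum_eq_zero fun i _ => h i
  bounded x := by
    classical
    refine ⟨(DirectSum.decompose 𝒜 x).support.sup id + 1, fun i hi => ?_⟩
    rw [GradedRing.proj_apply]
    by_contra h
    have : i ∈ (DirectSum.decompose 𝒜 x).support := by
      rw [DFinsupp.mem_support_iff]
      exact fun h0 => h (by rw [h0]; rfl)
    have := Finset.le_sup (f := id) this
    simp only [id] at this
    omega
  smul_mem i r hr l x hx := by
    have : x ∈ 𝒜 l := by rw [← hx]; exact SetLike.coe_mem _
    exact DirectSum.decompose_of_mem_same 𝒜 (SetLike.mul_mem_graded hr this)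

theorem self_proj [GradedAlgebra 𝒜] (i : ℕ) (r : R) :
    (self 𝒜).proj i r = GradedRing.proj 𝒜 i r := rfl

theorem self_proj_eq_self_iff [GradedAlgebra 𝒜] {i : ℕ} {r : R} :
    (self 𝒜).proj i r = r ↔ r ∈ 𝒜 i :=
  ⟨fun h => by rw [← h]; exact SetLike.coe_mem _, fun h => DirectSum.decompose_of_mem_same 𝒜 h⟩

/-- The grading of the free module `⨁ₐ R(-s a)`. -/
abbrev free (𝒜 : ℕ → Submodule K R) [GradedAlgebra 𝒜] {ι : Type} [Fintype ι] (s : ι → ℕ) :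
    ModuleGrading 𝒜 (ι → R) := (self 𝒜).pi s

theorem mem_freePiece_iff [GradedAlgebra 𝒜] {n : ℕ} {s : Fin n → ℕ} {j : ℕ} {x : Fin n → R} :
    x ∈ freePiece 𝒜 s j ↔ (free 𝒜 s).proj j x = x := by
  rw [freePiece, Submodule.mem_pi, funext_iff]
  refine forall_congr' fun a => ?_
  rw [pi_proj_apply]
  simp only [Set.mem_univ, true_imp_iff]
  split_ifs
  · exact self_proj_eq_self_iff.symm
  · rw [Submodule.mem_bot, eq_comm]

theorem one_mem_zero [GradedAlgebra 𝒜] : (1 : R) ∈ 𝒜 0 := SetLike.GradedOne.one_mem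

theorem free_single [GradedAlgebra 𝒜] {ι : Type} [Fintype ι] [DecidableEq ι] (s : ι → ℕ) (a : ι) :
    (free 𝒜 s).proj (s a) (Pi.single a 1) = Pi.single a 1 := by
  ext b
  rw [pi_proj_apply]
  by_cases h : b = a
  · subst h
    rw [if_pos le_rfl, Pi.single_eq_same, Nat.sub_self, self_proj_eq_self_iff]
    exact one_mem_zero
  · rw [Pi.single_eq_of_ne h, map_zero, ite_self]

end ModuleGrading

/-- Linear maps which are homogeneous of degree `0`. -/
def IsHomogeneousMap (g : ModuleGrading 𝒜 M) (g' : ModuleGrading 𝒜 M') (f : M →ₗ[R] M') : Prop :=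
  ∀ i x, f (g.proj i x) = g'.proj i (f x)

namespace IsHomogeneousMap

variable {g : ModuleGrading 𝒜 M} {g' : ModuleGrading 𝒜 M'} {g'' : ModuleGrading 𝒜 M''}

theorem comp {f' : M' →ₗ[R] M''} {f : M →ₗ[R] M'} (h' : IsHomogeneousMap g' g'' f')
    (h : IsHomogeneousMap g g' f) : IsHomogeneousMap g g'' (f' ∘ₗ f) := fun i x => by
  rw [LinearMap.comp_apply, h, h', LinearMap.comp_apply]

theorem homogeneous_ker {f : M →ₗ[R] M'} (h : IsHomogeneousMap g g' f) :
    g.Homogeneous (LinearMap.ker f) := fun i x hx => by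
  rw [LinearMap.mem_ker, h, LinearMap.mem_ker.mp hx, map_zero]

theorem symm {e : M ≃ₗ[R] M'} (h : IsHomogeneousMap g g' e.toLinearMap) :
    IsHomogeneousMap g' g e.symm.toLinearMap := fun i x => by
  apply e.injective
  have := h i (e.symm x)
  simpa using this.symm

theorem subtype (g : ModuleGrading 𝒜 M) (N : Submodule R M) (hN : g.Homogeneous N) :
    IsHomogeneousMap (g.sub N hN) g N.subtype := fun _ _ => rfl

theorem mkQ (g : ModuleGrading 𝒜 M) (N : Submodule R M) (hN : g.Homogeneous N) :
    IsHomogeneousMap g (g.quot N hN) N.mkQ := fun _ _ => rfl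

theorem codRestrict {f : M →ₗ[R] M'} (h : IsHomogeneousMap g g' f) (N : Submodule R M')
    (hN : g'.Homogeneous N) (hf : ∀ x, f x ∈ N) :
    IsHomogeneousMap g (g'.sub N hN) (f.codRestrict N hf) := fun i x => Subtype.ext (h i x)

theorem restrict {f : M →ₗ[R] M'} (h : IsHomogeneousMap g g' f) {N : Submodule R M}
    {N' : Submodule R M'} (hN : g.Homogeneous N) (hN' : g'.Homogeneous N')
    (hf : ∀ x ∈ N, f x ∈ N') :
    IsHomogeneousMap (g.sub N hN) (g'.sub N' hN') (f.restrict hf) :=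
  fun i x => Subtype.ext (h i x)

theorem exists_lift {f : M →ₗ[R] M'} (h : IsHomogeneousMap g g' f) (hf : Function.Surjective f)
    {i : ℕ} {y : M'} (hy : g'.proj i y = y) : ∃ x, g.proj i x = x ∧ f x = y := by
  obtain ⟨x, rfl⟩ := hf y
  exact ⟨g.proj i x, g.proj_self i x, by rw [h, hy]⟩

theorem linearCombination [GradedAlgebra 𝒜] {ι : Type} [Fintype ι] {s : ι → ℕ} {v : ι → M}
    (hv : ∀ a, g.proj (s a) (v a) = v a) :
    IsHomogeneousMap (ModuleGrading.free 𝒜 s) g (Fintype.linearCombination R v) := fun i x => by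
  rw [Fintype.linearCombination_apply, Fintype.linearCombination_apply, map_sum]
  refine Finset.sum_congr rfl fun a _ => ?_
  rw [g.proj_smul_homogeneous (hv a), ModuleGrading.pi_proj_apply, ModuleGrading.self_proj]
  split_ifs
  · rfl
  · rw [zero_smul]

end IsHomogeneousMap

end ModuleGradings

/-! ### Regularity bounds through partial free resolutions -/

section Regularity

variable {K : Type w} {R : Type u} [Field K] [CommRing R] [Algebra K R]

/-- The graded module `M` has, up to homological degree `k`, a resolution by finitely generated
graded free modules whose `i`-th term is generated in degrees at most `d + i`. -/
def RegLE (𝒜 : ℕ → Submodule K R) [GradedAlgebra 𝒜] : ℕ → ℕ → ∀ (M : Type u) [AddCommGroup M]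
    [Module R M], ModuleGrading 𝒜 M → Prop
  | 0, _, _, _, _, _ => True
  | k + 1, d, M, _, _, g => ∃ (ι : Type) (_ : Fintype ι) (s : ι → ℕ) (π : (ι → R) →ₗ[R] M)
      (h : IsHomogeneousMap (ModuleGrading.free 𝒜 s) g π), (∀ a, s a ≤ d) ∧
      Function.Surjective π ∧
      RegLE 𝒜 k (d + 1) (LinearMap.ker π) ((ModuleGrading.free 𝒜 s).sub _ h.homogeneous_ker)

/-- Short exact sequences of graded modules. -/
structure ShortExact {𝒜 : ℕ → Submodule K R} {A B C : Type u} [AddCommGroup A] [Module R A]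
    [AddCommGroup B] [Module R B] [AddCommGroup C] [Module R C] (gA : ModuleGrading 𝒜 A)
    (gB : ModuleGrading 𝒜 B) (gC : ModuleGrading 𝒜 C) (f : A →ₗ[R] B) (p : B →ₗ[R] C) : Prop where
  injective : Function.Injective f
  exact : Function.Exact f p
  surjective : Function.Surjective p
  left : IsHomogeneousMap gA gB f
  right : IsHomogeneousMap gB gC p

variable {𝒜 : ℕ → Submodule K R} [GradedAlgebra 𝒜] {M M' A B C : Type u}
  [AddCommGroup M] [Module R M] [AddCommGroup M'] [Module R M'] [AddCommGroup A] [Module R A]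
  [AddCommGroup B] [Module R B] [AddCommGroup C] [Module R C] {g : ModuleGrading 𝒜 M}
  {g' : ModuleGrading 𝒜 M'} {gA : ModuleGrading 𝒜 A} {gB : ModuleGrading 𝒜 B}
  {gC : ModuleGrading 𝒜 C} {k d d' : ℕ}

omit [GradedAlgebra 𝒜] in
theorem ShortExact.of_surjective {p : B →ₗ[R] C} (h : IsHomogeneousMap gB gC p)
    (hp : Function.Surjective p) :
    ShortExact (gB.sub _ h.homogeneous_ker) gB gC (LinearMap.ker p).subtype p :=
  ⟨Subtype.val_injective, LinearMap.exact_subtype_ker_map p, hp, .subtype _ _ _, h⟩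

/-- Graded free modules are projective in the graded category: each basis element is lifted within
its own degree. -/
theorem IsHomogeneousMap.exists_lift_free {κ : Type} [Fintype κ] {s : κ → ℕ}
    {π : (κ → R) →ₗ[R] C} (hπ : IsHomogeneousMap (ModuleGrading.free 𝒜 s) gC π) {p : B →ₗ[R] C}
    (h : IsHomogeneousMap gB gC p) (hp : Function.Surjective p) :
    ∃ L : (κ → R) →ₗ[R] B, IsHomogeneousMap (ModuleGrading.free 𝒜 s) gB L ∧
      ∀ x, p (L x) = π x := by
  classical
  have hl : ∀ a, ∃ x, gB.proj (s a) x = x ∧ p x = π (Pi.single a 1) := fun a =>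
    h.exists_lift hp (by rw [← hπ, ModuleGrading.free_single])
  choose v hv hpv using hl
  refine ⟨Fintype.linearCombination R v, IsHomogeneousMap.linearCombination hv, fun x => ?_⟩
  have : p ∘ₗ Fintype.linearCombination R v = π := by
    refine LinearMap.pi_ext' fun a => LinearMap.ext_ring ?_
    simp [hpv]
  exact LinearMap.congr_fun this x

namespace RegLE

theorem of_equiv (h : RegLE 𝒜 k d M g) (e : M ≃ₗ[R] M')
    (he : IsHomogeneousMap g g' e.toLinearMap) : RegLE 𝒜 k d M' g' := by
  induction k generalizing d M M' with
  | zero => trivial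
  | succ k ih =>
    obtain ⟨ι, _, s, π, hπ, hs, hsurj, hk⟩ := h
    refine ⟨ι, _, s, e.toLinearMap ∘ₗ π, he.comp hπ, hs, e.surjective.comp hsurj,
      ih hk (LinearEquiv.ofEq _ _ (LinearEquiv.ker_comp e π).symm) fun i x => Subtype.ext rfl⟩

theorem of_subsingleton [Subsingleton M] (g : ModuleGrading 𝒜 M) (k d : ℕ) : RegLE 𝒜 k d M g := by
  induction k generalizing d M with
  | zero => trivial
  | succ k ih =>
    exact ⟨Empty, inferInstance, Empty.elim, 0, fun i x => Subsingleton.elim _ _, fun a => a.elim,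
      fun y => ⟨0, Subsingleton.elim _ _⟩, ih _ _⟩

theorem mono (h : RegLE 𝒜 k d M g) (hd : d ≤ d') : RegLE 𝒜 k d' M g := by
  induction k generalizing d d' M with
  | zero => trivial
  | succ k ih =>
    obtain ⟨ι, _, s, π, hπ, hs, hsurj, hk⟩ := h
    exact ⟨ι, _, s, π, hπ, fun a => (hs a).trans hd, hsurj, ih hk (by omega)⟩

theorem of_succ (h : RegLE 𝒜 (k + 1) d M g) : RegLE 𝒜 k d M g := by
  induction k generalizing d M with
  | zero => trivial
  | succ k ih =>
    obtain ⟨ι, _, s, π, hπ, hs, hsurj, hk⟩ := h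
    exact ⟨ι, _, s, π, hπ, hs, hsurj, ih hk⟩

theorem free {ι : Type} [Fintype ι] {s : ι → ℕ} (hs : ∀ a, s a ≤ d) (k : ℕ) :
    RegLE 𝒜 k d (ι → R) (ModuleGrading.free 𝒜 s) := by
  cases k with
  | zero => trivial
  | succ k =>
    refine ⟨ι, inferInstance, s, LinearMap.id, fun _ _ => rfl, hs, Function.surjective_id, ?_⟩
    have : Subsingleton (LinearMap.ker (LinearMap.id : (ι → R) →ₗ[R] (ι → R))) := by
      rw [LinearMap.ker_id]
      infer_instance
    exact of_subsingleton _ _ _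

/-- The horseshoe lemma: the covers of A and C combine to a cover Ψ of B, and the kernels again form
a short exact sequence, to which the induction applies. -/
theorem extension {f : A →ₗ[R] B} {p : B →ₗ[R] C} (H : ShortExact gA gB gC f p)
    (hA : RegLE 𝒜 k d A gA) (hC : RegLE 𝒜 k d C gC) : RegLE 𝒜 k d B gB := by
  classical
  induction k generalizing d A B C with
  | zero => trivial
  | succ k ih =>
    obtain ⟨ι, _, s, π, hπ, hs, hsurj, hk⟩ := hA
    obtain ⟨κ, _, s', π', hπ', hs', hsurj', hk'⟩ := hC
    obtain ⟨L, hLh, hpL⟩ := hπ'.exists_lift_free H.right H.surjective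
    have hpf : ∀ x, p (f x) = 0 := fun x => (H.exact (f x)).mpr ⟨x, rfl⟩
    set Ψ : (ι ⊕ κ → R) →ₗ[R] B := f ∘ₗ π ∘ₗ LinearMap.funLeft R R Sum.inl +
      L ∘ₗ LinearMap.funLeft R R Sum.inr with hΨ
    have hΨx : ∀ x, Ψ x = f (π (x ∘ Sum.inl)) + L (x ∘ Sum.inr) := fun x => rfl
    have hpΨ : ∀ x, p (Ψ x) = π' (x ∘ Sum.inr) := fun x => by
      rw [hΨx, map_add, hpf, zero_add, hpL]
    have hΨh : IsHomogeneousMap (ModuleGrading.free 𝒜 (Sum.elim s s')) gB Ψ := by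
      intro i x
      rw [hΨx, hΨx, map_add, ← hLh, ← H.left, ← hπ]
      rfl
    refine ⟨ι ⊕ κ, inferInstance, Sum.elim s s', Ψ, hΨh, fun a => ?_, fun y => ?_, ?_⟩
    · cases a with
      | inl a => exact hs a
      | inr a => exact hs' a
    · obtain ⟨z, hz⟩ := hsurj' (p y)
      obtain ⟨a, ha⟩ := (H.exact (y - L z)).mp (by rw [map_sub, hpL, hz, sub_self])
      obtain ⟨x, rfl⟩ := hsurj a
      refine ⟨Sum.elim x z, ?_⟩
      rw [hΨx, Sum.elim_comp_inl, Sum.elim_comp_inr, ha, sub_add_cancel]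
    · let F : (ι → R) →ₗ[R] (ι ⊕ κ → R) :=
        { toFun := fun x => Sum.elim x 0
          map_add' := fun x y => by ext (a | a) <;> simp
          map_smul' := fun r x => by ext (a | a) <;> simp }
      have hFh : IsHomogeneousMap (ModuleGrading.free 𝒜 s)
          (ModuleGrading.free 𝒜 (Sum.elim s s')) F := by
        intro i x
        ext (a | a)
        · rfl
        · change (0 : R) = if s' a ≤ i then (ModuleGrading.self 𝒜).proj _ (0 : R) else 0
          rw [map_zero, ite_self]
      have hF : ∀ x ∈ LinearMap.ker π, F x ∈ LinearMap.ker Ψ := fun x hx => by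
        rw [LinearMap.mem_ker, hΨx]
        change f (π x) + L 0 = 0
        rw [LinearMap.mem_ker.mp hx, map_zero, map_zero, add_zero]
      have hG : ∀ x ∈ LinearMap.ker Ψ, LinearMap.funLeft R R Sum.inr x ∈ LinearMap.ker π' :=
        fun x hx => by
          rw [LinearMap.mem_ker]
          change π' (x ∘ Sum.inr) = 0
          rw [← hpΨ, LinearMap.mem_ker.mp hx, map_zero]
      have hGh : IsHomogeneousMap (ModuleGrading.free 𝒜 (Sum.elim s s'))
          (ModuleGrading.free 𝒜 s') (LinearMap.funLeft R R Sum.inr) := fun i x => rfl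
      refine ih (f := F.restrict hF) (p := (LinearMap.funLeft R R Sum.inr).restrict hG)
        ⟨fun x y hxy => ?_, fun y => ⟨fun hy => ?_, ?_⟩, fun z => ?_,
          hFh.restrict _ _ hF, hGh.restrict _ _ hG⟩ hk hk'
      · apply Subtype.ext
        exact congrArg (fun z => z ∘ Sum.inl) (congrArg Subtype.val hxy)
      · have hy' : (y : ι ⊕ κ → R) ∘ Sum.inr = 0 := congrArg Subtype.val hy
        have hy2 : Ψ y = 0 := y.2
        rw [hΨx, hy', map_zero, add_zero] at hy2
        refine ⟨⟨(y : ι ⊕ κ → R) ∘ Sum.inl, ?_⟩, Subtype.ext ?_⟩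
        · exact H.injective (by rw [hy2, map_zero])
        · change Sum.elim ((y : ι ⊕ κ → R) ∘ Sum.inl) 0 = _
          rw [← hy', Sum.elim_comp_inl_inr]
      · rintro ⟨x, rfl⟩
        rfl
      · have hz : p (L z) = 0 := by rw [hpL]; exact z.2
        obtain ⟨a, ha⟩ := (H.exact _).mp hz
        obtain ⟨x, hx⟩ := hsurj (-a)
        refine ⟨⟨Sum.elim x z, ?_⟩, Subtype.ext rfl⟩
        rw [LinearMap.mem_ker, hΨx, Sum.elim_comp_inl, Sum.elim_comp_inr, hx, map_neg, ha,
          neg_add_cancel]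

/-- Minimality would make this obvious; without it, the complement W = ker r is used. If π covers
M', then r ∘ π covers M, and its kernel is an extension of W by ker π. -/
theorem retract (h : RegLE 𝒜 k d M' g') {f : M →ₗ[R] M'} {r : M' →ₗ[R] M}
    (hf : IsHomogeneousMap g g' f) (hr : IsHomogeneousMap g' g r) (hrf : ∀ x, r (f x) = x) :
    RegLE 𝒜 k d M g := by
  induction k generalizing d M M' with
  | zero => trivial
  | succ k ih =>
    have h' := h.of_succ
    obtain ⟨ι, _, s, π, hπ, hs, hsurj, hk⟩ := h
    have hw : ∀ y, (LinearMap.id - f ∘ₗ r : M' →ₗ[R] M') y ∈ LinearMap.ker r := fun y => by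
      simp [hrf]
    have hwh : IsHomogeneousMap g' (g'.sub _ hr.homogeneous_ker)
        ((LinearMap.id - f ∘ₗ r).codRestrict _ hw) :=
      IsHomogeneousMap.codRestrict (fun i x => by
        simp [hf i, hr i]) _ _ hw
    -- W is itself a retract of M', so the induction hypothesis, one homological step shorter,
    -- applies to it.
    have hW : RegLE 𝒜 k d (LinearMap.ker r) (g'.sub _ hr.homogeneous_ker) :=
      ih h' (IsHomogeneousMap.subtype _ _ _) hwh fun x => Subtype.ext (by
        have : r x = 0 := x.2
        simp [this])
    refine ⟨ι, _, s, r ∘ₗ π, hr.comp hπ, hs, (Function.LeftInverse.surjective hrf).comp hsurj, ?_⟩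
    have h1 : ∀ x ∈ LinearMap.ker π, LinearMap.id (R := R) x ∈ LinearMap.ker (r ∘ₗ π) :=
      fun x hx => by
        rw [LinearMap.id_apply, LinearMap.mem_ker, LinearMap.comp_apply, LinearMap.mem_ker.mp hx,
          map_zero]
    have h2 : ∀ x ∈ LinearMap.ker (r ∘ₗ π), π x ∈ LinearMap.ker r := fun x hx => hx
    have hid : IsHomogeneousMap (ModuleGrading.free 𝒜 s) (ModuleGrading.free 𝒜 s)
      LinearMap.id := fun _ _ => rfl
    refine extension (f := LinearMap.id.restrict h1) (p := π.restrict h2)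
      ⟨fun x y hxy => ?_, fun y => ⟨fun hy => ?_, ?_⟩, fun z => ?_, hid.restrict _ _ h1,
        hπ.restrict _ _ h2⟩ hk (hW.mono (Nat.le_succ d))
    · have hxy' := congrArg Subtype.val hxy
      exact Subtype.ext hxy'
    · exact ⟨⟨y, congrArg Subtype.val hy⟩, rfl⟩
    · rintro ⟨x, rfl⟩
      exact Subtype.ext x.2
    · obtain ⟨x, hx⟩ := hsurj z
      exact ⟨⟨x, by rw [LinearMap.mem_ker, LinearMap.comp_apply, hx]; exact z.2⟩, Subtype.ext hx⟩

/-- A form of `retract` for maps that are naturally defined with values in the ambient modules. -/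
theorem retract_submodule {N : Submodule R M} {X : Submodule R M'} {hN : g.Homogeneous N}
    {hX : g'.Homogeneous X} (h : RegLE 𝒜 k d X (g'.sub X hX)) {f : N →ₗ[R] M'} {r : M' →ₗ[R] M}
    (hf : IsHomogeneousMap (g.sub N hN) g' f) (hr : IsHomogeneousMap g' g r) (hfX : ∀ x, f x ∈ X)
    (hrN : ∀ x ∈ X, r x ∈ N) (hrf : ∀ x, r (f x) = x) : RegLE 𝒜 k d N (g.sub N hN) :=
  h.retract (f := f.codRestrict X hfX) (r := (r ∘ₗ X.subtype).codRestrict N fun x => hrN x x.2)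
    (hf.codRestrict _ _ _) ((hr.comp (.subtype _ _ _)).codRestrict _ _ _)
    fun x => Subtype.ext (hrf x)

/-- Replaces the inequality reg A ≤ max(reg B, reg C + 1). A free cover H of C lifts to B, and A ⊕ H
→ B is then onto with kernel isomorphic to the first syzygies of C. So A ⊕ H is an extension of
modules with known bounds, and A is a retract of it. Passing to the syzygies of C is what uses up
one homological step. -/
theorem of_shortExact {f : A →ₗ[R] B} {p : B →ₗ[R] C} (H : ShortExact gA gB gC f p)
    (hB : RegLE 𝒜 k (d + 1) B gB) (hC : RegLE 𝒜 (k + 1) d C gC) : RegLE 𝒜 k (d + 1) A gA := by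
  classical
  obtain ⟨κ, _, s', π', hπ', hs', hsurj', hk'⟩ := hC
  obtain ⟨L, hLh, hpL⟩ := hπ'.exists_lift_free H.right H.surjective
  have hpf : ∀ x, p (f x) = 0 := fun x => (H.exact (f x)).mpr ⟨x, rfl⟩
  let gH := ModuleGrading.free 𝒜 s'
  let q : A × (κ → R) →ₗ[R] B := f.coprod L
  have hq : IsHomogeneousMap (gA.prod gH) gB q := fun i x => by
    simp [q, ModuleGrading.prod_proj, H.left i, hLh i, gH]
  have hqs : Function.Surjective q := fun y => by
    obtain ⟨z, hz⟩ := hsurj' (p y)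
    obtain ⟨a, ha⟩ := (H.exact (y - L z)).mp (by rw [map_sub, hpL, hz, sub_self])
    exact ⟨(a, z), by simp [q, ha]⟩
  have h2 : ∀ x ∈ LinearMap.ker q, LinearMap.snd R A (κ → R) x ∈ LinearMap.ker π' := fun x hx => by
    have h3 : f x.1 + L x.2 = 0 := hx
    rw [LinearMap.mem_ker, LinearMap.snd_apply, ← hpL]
    have := congrArg p h3
    rwa [map_add, hpf, zero_add, map_zero] at this
  have hsnd : IsHomogeneousMap (gA.prod gH) gH (LinearMap.snd R A (κ → R)) := fun _ _ => rfl
  let e : LinearMap.ker q ≃ₗ[R] LinearMap.ker π' := LinearEquiv.ofBijective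
    ((LinearMap.snd R A (κ → R)).restrict h2) ⟨fun x y hxy => by
      have hx : f x.1.1 + L x.1.2 = 0 := x.2
      have hy : f y.1.1 + L y.1.2 = 0 := y.2
      have hxy' : x.1.2 = y.1.2 := congrArg Subtype.val hxy
      rw [hxy', ← hy] at hx
      exact Subtype.ext (Prod.ext (H.injective (add_right_cancel hx)) hxy'), fun z => by
      have hz : p (L z) = 0 := by rw [hpL]; exact z.2
      obtain ⟨a, ha⟩ := (H.exact _).mp hz
      refine ⟨⟨(-a, z), ?_⟩, Subtype.ext rfl⟩
      change f (-a) + L z = 0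
      rw [map_neg, ha, neg_add_cancel]⟩
  have he : IsHomogeneousMap ((gA.prod gH).sub _ hq.homogeneous_ker)
      (gH.sub _ hπ'.homogeneous_ker) e.toLinearMap := hsnd.restrict _ _ h2
  have hprod : RegLE 𝒜 k (d + 1) (A × (κ → R)) (gA.prod gH) :=
    extension (.of_surjective hq hqs) (hk'.of_equiv e.symm he.symm) hB
  exact hprod.retract (f := LinearMap.inl R A (κ → R)) (r := LinearMap.fst R A (κ → R))
    (fun i x => by simp [ModuleGrading.prod_proj]) (fun _ _ => rfl) fun _ => rfl

/-- Direct sums of copies of a resolution, shifted by c; the basis of each term is indexed by pairs.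
-/
theorem pi {ι : Type} [Fintype ι] (h : RegLE 𝒜 k d M g) (c : ℕ) :
    RegLE 𝒜 k (d + c) (ι → M) (g.pi fun _ => c) := by
  induction k generalizing d M with
  | zero => trivial
  | succ k ih =>
    obtain ⟨κ, _, s, π, hπ, hs, hsurj, hk⟩ := h
    let Ψ : (ι × κ → R) →ₗ[R] (ι → M) :=
      LinearMap.pi fun a => π ∘ₗ LinearMap.funLeft R R (fun b => (a, b))
    have hΨx : ∀ x a, Ψ x a = π (fun b => x (a, b)) := fun x a => rfl
    let s' : ι × κ → ℕ := fun q => s q.2 + c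
    have hp : ∀ i (x : ι × κ → R) a, (fun b => (ModuleGrading.free 𝒜 s').proj i x (a, b)) =
        if c ≤ i then (ModuleGrading.free 𝒜 s).proj (i - c) (fun b => x (a, b)) else 0 := by
      intro i x a
      ext b
      rw [ModuleGrading.pi_proj_apply]
      by_cases h1 : s b + c ≤ i
      · have h2 : i - (s b + c) = i - c - s b := by omega
        rw [if_pos h1, if_pos (by omega), ModuleGrading.pi_proj_apply, if_pos (by omega), ← h2]
      · rw [if_neg h1]
        split_ifs with h2
        · rw [ModuleGrading.pi_proj_apply, if_neg (by omega)]
        · rfl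
    have hΨh : IsHomogeneousMap (ModuleGrading.free 𝒜 s') (g.pi fun _ => c) Ψ := by
      intro i x
      ext a
      rw [hΨx, hp, ModuleGrading.pi_proj_apply, hΨx]
      split_ifs
      · exact hπ _ _
      · exact map_zero _
    have e1 : ∀ x : LinearMap.ker Ψ, ∀ a, (fun b => (x : ι × κ → R) (a, b)) ∈ LinearMap.ker π :=
      fun x a => congrFun x.2 a
    let e : LinearMap.ker Ψ ≃ₗ[R] (ι → LinearMap.ker π) :=
      { toFun := fun x a => ⟨_, e1 x a⟩
        invFun := fun y => ⟨fun q => (y q.1 : κ → R) q.2, funext fun a => (y a).2⟩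
        map_add' := fun x y => rfl
        map_smul' := fun r x => rfl
        left_inv := fun x => rfl
        right_inv := fun y => rfl }
    have he : IsHomogeneousMap ((ModuleGrading.free 𝒜 s').sub _ hΨh.homogeneous_ker)
        (((ModuleGrading.free 𝒜 s).sub _ hπ.homogeneous_ker).pi fun _ => c) e.toLinearMap := by
      intro i x
      ext a : 1
      apply Subtype.ext
      refine (hp i x a).trans ?_
      rw [ModuleGrading.pi_proj_apply]
      split_ifs <;> rfl
    refine ⟨ι × κ, inferInstance, s', Ψ, hΨh, fun a => Nat.add_le_add_right (hs _) c, fun y => ?_,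
      ?_⟩
    · choose x hx using fun a => hsurj (y a)
      exact ⟨fun q => x q.1 q.2, funext hx⟩
    · have := ih hk
      rw [Nat.add_right_comm] at this
      exact this.of_equiv e.symm he.symm

end RegLE

end Regularity

/-! ### Minimal generators and minimal free covers -/

section MinimalCovers

variable {K : Type w} {R : Type u} [Field K] [CommRing R] [Algebra K R]
  {𝒜 : ℕ → Submodule K R} [GradedAlgebra 𝒜] {M M' : Type u}
  [AddCommGroup M] [Module R M] [AddCommGroup M'] [Module R M'] {g : ModuleGrading 𝒜 M}

theorem mem_maxIdeal_iff {r : R} : r ∈ maxIdeal 𝒜 ↔ GradedRing.proj 𝒜 0 r = 0 :=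
  HomogeneousIdeal.mem_irrelevant_iff 𝒜 r

theorem one_notMem_maxIdeal [Nontrivial R] : (1 : R) ∉ maxIdeal 𝒜 := by
  rw [mem_maxIdeal_iff, ← ModuleGrading.self_proj,
    ModuleGrading.self_proj_eq_self_iff.mpr ModuleGrading.one_mem_zero]
  exact one_ne_zero

variable (𝒜) in
theorem homogeneous_maxIdeal : (ModuleGrading.self 𝒜).Homogeneous (maxIdeal 𝒜) := fun i x hx => by
  rw [mem_maxIdeal_iff, ← ModuleGrading.self_proj] at *
  rw [ModuleGrading.proj_proj]
  split_ifs with h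
  · exact h ▸ hx
  · rfl

theorem mem_maxIdeal_smul_top {ι : Type} [Finite ι] {x : ι → R} :
    x ∈ maxIdeal 𝒜 • (⊤ : Submodule R (ι → R)) ↔ ∀ a, x a ∈ maxIdeal 𝒜 := by
  classical
  have := Fintype.ofFinite ι
  refine ⟨fun h a => ?_, fun h => ?_⟩
  · refine Submodule.smul_induction_on (p := fun y => y a ∈ maxIdeal 𝒜) h ?_ ?_
    · intro r hr y _
      exact Ideal.mul_mem_right _ _ hr
    · intro y z hy hz
      exact Ideal.add_mem _ hy hz
  · rw [pi_eq_sum_univ' x]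
    exact Submodule.sum_mem _ fun a _ => Submodule.smul_mem_smul (h a) trivial

theorem single_notMem_maxIdeal_smul_top [Nontrivial R] {ι : Type} [Finite ι] [DecidableEq ι]
    (a : ι) : (Pi.single a 1 : ι → R) ∉ maxIdeal 𝒜 • (⊤ : Submodule R (ι → R)) := fun h => by
  have := mem_maxIdeal_smul_top.mp h a
  rw [Pi.single_eq_same] at this
  exact one_notMem_maxIdeal this

theorem IsStandardGraded.exists_algebraMap (hR : IsStandardGraded 𝒜) {r : R} (hr : r ∈ 𝒜 0) :
    ∃ k : K, algebraMap K R k = r := by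
  rwa [hR.zero_eq, Submodule.mem_one] at hr

theorem proj_mem (r : R) (i : ℕ) : GradedRing.proj 𝒜 i r ∈ 𝒜 i := SetLike.coe_mem _

/-- A graded module generated by finitely many homogeneous elements has a minimal system of
homogeneous generators. -/
theorem exists_minimal_generators (hR : IsStandardGraded 𝒜) (D : ℕ → Prop) {ι : Type} [Fintype ι]
    {s : ι → ℕ} {v : ι → M} (hv : ∀ a, g.proj (s a) (v a) = v a) (hs : ∀ a, D (s a))
    (hspan : Submodule.span R (Set.range v) = ⊤) :
    ∃ (m : ℕ) (s' : Fin m → ℕ) (v' : Fin m → M), (∀ a, g.proj (s' a) (v' a) = v' a) ∧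
      (∀ a, D (s' a)) ∧ Submodule.span R (Set.range v') = ⊤ ∧
      LinearMap.ker (Fintype.linearCombination R v') ≤
        maxIdeal 𝒜 • (⊤ : Submodule R (Fin m → R)) := by
  classical
  have hex : ∃ m, ∃ (s' : Fin m → ℕ) (v' : Fin m → M), (∀ a, g.proj (s' a) (v' a) = v' a) ∧
      (∀ a, D (s' a)) ∧ Submodule.span R (Set.range v') = ⊤ := by
    refine ⟨Fintype.card ι, s ∘ (Fintype.equivFin ι).symm, v ∘ (Fintype.equivFin ι).symm,
      fun a => hv _, fun a => hs _, ?_⟩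
    rw [EquivLike.range_comp, hspan]
  obtain ⟨s', v', hv', hs', hspan'⟩ := Nat.find_spec hex
  -- Minimality is recorded as a hypothesis, so that the number of generators can become a variable
  -- and be split into cases below.
  have hmin : ∀ k, _ → ¬ _ := fun k hk => Nat.find_min hex (m := k) hk
  refine ⟨Nat.find hex, s', v', hv', hs', hspan', ?_⟩
  revert s' v' hmin
  generalize Nat.find hex = m
  intro s' v' hv' hs' hspan' hmin x hx
  rw [mem_maxIdeal_smul_top]
  intro a
  by_contra ha
  rw [mem_maxIdeal_iff] at ha
  -- A coordinate outside 𝔪 has a nonzero scalar of K as its part of degree 0, which makes the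
  -- corresponding generator redundant.
  obtain ⟨k, hk⟩ := hR.exists_algebraMap (proj_mem (𝒜 := 𝒜) (x a) 0)
  have hk0 : k ≠ 0 := by
    rintro rfl
    exact ha (by rw [← hk, map_zero])
  obtain _ | m := m
  · exact a.elim0
  refine hmin m (Nat.lt_succ_self m) ⟨s' ∘ a.succAbove, v' ∘ a.succAbove, fun b => hv' _,
    fun b => hs' _, ?_⟩
  rw [eq_top_iff, ← hspan', Submodule.span_le]
  have hmem : ∀ b, v' (a.succAbove b) ∈
      Submodule.span R (Set.range (v' ∘ a.succAbove)) := fun b =>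
    Submodule.subset_span ⟨b, rfl⟩
  rintro _ ⟨b, rfl⟩
  by_cases hb : b = a
  · subst hb
    rw [LinearMap.mem_ker, Fintype.linearCombination_apply] at hx
    -- In the degree of v' b the relation has the scalar k as coefficient of v' b, and dividing by k
    -- expresses v' b through the others.
    have h1 := congrArg (g.proj (s' b)) hx
    rw [map_sum, map_zero, Fin.sum_univ_succAbove _ b, g.proj_smul_homogeneous (hv' b),
      if_pos le_rfl, Nat.sub_self, ← hk] at h1
    have h2 : algebraMap K R k • v' b ∈ Submodule.span R (Set.range (v' ∘ b.succAbove)) := by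
      rw [eq_neg_of_add_eq_zero_left h1]
      refine Submodule.neg_mem _ (Submodule.sum_mem _ fun c _ => ?_)
      rw [g.proj_smul_homogeneous (hv' _)]
      split_ifs
      · exact Submodule.smul_mem _ _ (hmem c)
      · exact Submodule.zero_mem _
    have h3 := Submodule.smul_mem _ (algebraMap K R k⁻¹) h2
    rwa [smul_smul, ← map_mul, inv_mul_cancel₀ hk0, map_one, one_smul] at h3
  · obtain ⟨c, rfl⟩ := Fin.exists_succAbove_eq hb
    exact hmem c

omit [GradedAlgebra 𝒜] in
theorem exists_homogeneous_generators [Module.Finite R M] (g : ModuleGrading 𝒜 M) :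
    ∃ (ι : Type) (_ : Fintype ι) (s : ι → ℕ) (v : ι → M), (∀ a, g.proj (s a) (v a) = v a) ∧
      Submodule.span R (Set.range v) = ⊤ := by
  obtain ⟨n, w, hw⟩ := Module.Finite.exists_fin (R := R) (M := M)
  choose N hN using fun a => g.sum_proj (w a)
  refine ⟨Σ a, Fin (N a), inferInstance, fun q => q.2, fun q => g.proj q.2 (w q.1),
    fun q => g.proj_self _ _, ?_⟩
  rw [eq_top_iff, ← hw, Submodule.span_le]
  rintro _ ⟨a, rfl⟩
  rw [SetLike.mem_coe, ← hN a, Finset.sum_range]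
  exact Submodule.sum_mem _ fun i _ => Submodule.subset_span ⟨⟨a, i⟩, rfl⟩

theorem linearCombination_surjective {ι : Type} [Fintype ι] {v : ι → M}
    (h : Submodule.span R (Set.range v) = ⊤) :
    Function.Surjective (Fintype.linearCombination R v) := by
  rw [← LinearMap.range_eq_top, Fintype.range_linearCombination, h]

/-- Minimal covers by graded free modules. -/
theorem exists_minimal_cover [Nontrivial R] (hR : IsStandardGraded 𝒜) (D : ℕ → Prop) {ι : Type}
    [Fintype ι] {s : ι → ℕ} {v : ι → M} (hv : ∀ a, g.proj (s a) (v a) = v a) (hs : ∀ a, D (s a))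
    (hspan : Submodule.span R (Set.range v) = ⊤) :
    ∃ (m : ℕ) (s' : Fin m → ℕ) (π : (Fin m → R) →ₗ[R] M),
      IsHomogeneousMap (ModuleGrading.free 𝒜 s') g π ∧ Function.Surjective π ∧
      LinearMap.ker π ≤ maxIdeal 𝒜 • (⊤ : Submodule R (Fin m → R)) ∧
      ∀ a, D (s' a) ∧ ∃ x, x ≠ 0 ∧ g.proj (s' a) x = x := by
  obtain ⟨m, s', v', hv', hs', hspan', hker⟩ := exists_minimal_generators hR D hv hs hspan
  refine ⟨m, s', _, IsHomogeneousMap.linearCombination hv', linearCombination_surjective hspan',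
    hker, fun a => ⟨hs' a, v' a, fun h0 => ?_, hv' a⟩⟩
  refine single_notMem_maxIdeal_smul_top (𝒜 := 𝒜) a (hker ?_)
  simp [h0]

theorem exists_minimal_cover_of_regLE [Nontrivial R] (hR : IsStandardGraded 𝒜) {k d : ℕ}
    (h : RegLE 𝒜 (k + 1) d M g) :
    ∃ (m : ℕ) (s' : Fin m → ℕ) (π : (Fin m → R) →ₗ[R] M),
      IsHomogeneousMap (ModuleGrading.free 𝒜 s') g π ∧ Function.Surjective π ∧
      LinearMap.ker π ≤ maxIdeal 𝒜 • (⊤ : Submodule R (Fin m → R)) ∧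
      ∀ a, s' a ≤ d ∧ ∃ x, x ≠ 0 ∧ g.proj (s' a) x = x := by
  classical
  obtain ⟨ι, _, s, π, hπ, hs, hsurj, -⟩ := h
  refine exists_minimal_cover hR (fun j => j ≤ d) (s := s) (v := fun a => π (Pi.single a 1))
    (fun a => ?_) hs ?_
  · rw [← hπ, ModuleGrading.free_single]
  · have : π = Fintype.linearCombination R fun a => π (Pi.single a 1) := by
      refine LinearMap.pi_ext' fun a => LinearMap.ext_ring ?_
      simp
    rw [← Fintype.range_linearCombination, ← this, LinearMap.range_eq_top.mpr hsurj]

end MinimalCovers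

/-! ### Building resolutions by iterating a syzygy step -/

section Resolutions

variable {K : Type w} {R : Type u} [Field K] [CommRing R] [Algebra K R]
  {𝒜 : ℕ → Submodule K R} [GradedAlgebra 𝒜]

/-- A homogeneous submodule of a graded free module, with a property `Φ i`. -/
structure Syzygy (Φ : ∀ (_ n : ℕ) (_ : Fin n → ℕ), Submodule R (Fin n → R) → Prop) (i : ℕ) where
  rank : ℕ
  shift : Fin rank → ℕ
  submodule : Submodule R (Fin rank → R)
  prop : Φ i rank shift submodule

/-- The invariant Φ is attached to each syzygy module and its ambient free module. It is
instantiated twice: for the minimal resolution of the residue field, and for linear resolutions. -/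
theorem exists_resolution {M : Type u} [AddCommGroup M] [Module R M] [Module K M]
    {ℳ : ℕ → Submodule K M}
    (Φ : ∀ (_ n : ℕ) (_ : Fin n → ℕ), Submodule R (Fin n → R) → Prop)
    (step : ∀ i n s N, Φ i n s N → ∃ (m : ℕ) (s' : Fin m → ℕ) (d : (Fin m → R) →ₗ[R] (Fin n → R)),
      IsHomogeneousMap (ModuleGrading.free 𝒜 s') (ModuleGrading.free 𝒜 s) d ∧
      LinearMap.range d = N ∧ Φ (i + 1) m s' (LinearMap.ker d))
    {n : ℕ} {s : Fin n → ℕ} (aug : (Fin n → R) →ₗ[R] M)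
    (haug : ∀ a, aug (Pi.single a 1) ∈ ℳ (s a)) (hsurj : Function.Surjective aug)
    (h0 : Φ 0 n s (LinearMap.ker aug)) :
    ∃ F : GradedFreeResolution 𝒜 ℳ, Φ 0 (F.rank 0) (F.shift 0) (LinearMap.ker F.aug) ∧
      ∀ i, Φ (i + 1) (F.rank (i + 1)) (F.shift (i + 1)) (LinearMap.ker (F.d i)) := by
  choose m s' d hd hrange hΦ using fun i (S : Syzygy Φ i) =>
    step i S.rank S.shift S.submodule S.prop
  let seq : ∀ i, Syzygy Φ i := fun i => Nat.rec ⟨n, s, LinearMap.ker aug, h0⟩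
    (fun i S => ⟨m i S, s' i S, LinearMap.ker (d i S), hΦ i S⟩) i
  refine ⟨{ rank := fun i => (seq i).rank
            shift := fun i => (seq i).shift
            aug := aug
            d := fun i => d i (seq i)
            aug_mem := haug
            d_mem := fun i a => ?_
            aug_surjective := hsurj
            exact_zero := LinearMap.exact_iff.mpr (hrange 0 (seq 0)).symm
            exact_succ := fun i => LinearMap.exact_iff.mpr (hrange (i + 1) (seq (i + 1))).symm },
    h0, fun i => hΦ i (seq i)⟩
  rw [ModuleGrading.mem_freePiece_iff, ← hd i (seq i)]
  congr 1
  exact ModuleGrading.free_single _ _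

end Resolutions

/-! ### Consequences of Koszulness: truncations and linear resolutions -/

section KoszulAlgebras

variable {K : Type w} {R : Type u} [Field K] [CommRing R] [Algebra K R]
  {𝒜 : ℕ → Submodule K R} [GradedAlgebra 𝒜]

theorem IsStandardGraded.isNoetherianRing (hR : IsStandardGraded 𝒜) : IsNoetherianRing R := by
  obtain ⟨S, hS⟩ := Module.finite_def.mp hR.finite_one
  have hfg : (𝒜 1).FG := (Submodule.fg_top _).mp ⟨S, hS⟩
  obtain ⟨T, hT⟩ := hfg
  have : Algebra.FiniteType K R := ⟨⟨T, by rw [← Algebra.adjoin_span, hT, hR.adjoin_one]⟩⟩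
  exact Algebra.FiniteType.isNoetherianRing K R

/-- In a minimal resolution the differential of F ⊗ R/𝔪 is zero, so every basis element survives in
Tor. -/
theorem GradedFreeResolution.torPiece_ne_bot [Nontrivial R] {M : Type u} [AddCommGroup M]
    [Module R M] [Module K M] {ℳ : ℕ → Submodule K M} (F : GradedFreeResolution 𝒜 ℳ)
    (hF : ∀ i, LinearMap.range (F.d i) ≤ maxIdeal 𝒜 • (⊤ : Submodule R (Fin (F.rank i) → R)))
    (i : ℕ) (a : Fin (F.rank i)) : F.torPiece i (F.shift i a) ≠ ⊥ := by
  intro h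
  have hcyc : (Pi.single a 1 : Fin (F.rank i) → R) ∈ F.torCycles i := by
    cases i with
    | zero => trivial
    | succ i => exact hF i ⟨_, rfl⟩
  have hmem : (F.torBoundaries i).mkQ (Pi.single a 1) ∈ F.torPiece i (F.shift i a) :=
    ⟨Pi.single a 1, ⟨hcyc, ModuleGrading.mem_freePiece_iff.mpr (ModuleGrading.free_single _ _)⟩, rfl⟩
  rw [h, Submodule.mem_bot, Submodule.mkQ_apply, Submodule.Quotient.mk_eq_zero,
    GradedFreeResolution.torBoundaries, sup_eq_right.mpr (hF i)] at hmem
  exact single_notMem_maxIdeal_smul_top a hmem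

/-- `TorNonzero` only asks for some resolution, so this F itself witnesses the nonvanishing, and
independence of Tor from the resolution is not needed. -/
theorem GradedFreeResolution.shift_le_of_reg [Nontrivial R] {M : Type u} [AddCommGroup M]
    [Module R M] [Module K M] {ℳ : ℕ → Submodule K M} (F : GradedFreeResolution 𝒜 ℳ)
    (hF : ∀ i, LinearMap.range (F.d i) ≤ maxIdeal 𝒜 • (⊤ : Submodule R (Fin (F.rank i) → R)))
    (hreg : reg 𝒜 ℳ ≤ 0) (i : ℕ) (a : Fin (F.rank i)) : F.shift i a ≤ i := by
  have h1 : ((F.shift i a : ℕ) : EReal) ≤ topDegree 𝒜 ℳ i :=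
    le_sSup ⟨_, ⟨F, F.torPiece_ne_bot hF i a⟩, rfl⟩
  have h2 : topDegree 𝒜 ℳ i - (i : EReal) ≤ 0 :=
    (le_iSup (fun i : ℕ => topDegree 𝒜 ℳ i - (i : EReal)) i).trans hreg
  have h3 : ((F.shift i a : ℕ) : EReal) - (i : EReal) ≤ 0 :=
    (EReal.sub_le_sub h1 le_rfl).trans h2
  have h4 : ((F.shift i a : ℝ) : EReal) - ((i : ℝ) : EReal) ≤ ((0 : ℝ) : EReal) := h3
  rw [← EReal.coe_sub, EReal.coe_le_coe_iff, sub_nonpos] at h4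
  exact_mod_cast h4

/-- The tail of the resolution resolves each syzygy module. All kernels are treated together because
the induction on k passes from one to the next. -/
theorem GradedFreeResolution.regLE_ker {M : Type u} [AddCommGroup M]
    [Module R M] [Module K M] {ℳ : ℕ → Submodule K M} (F : GradedFreeResolution 𝒜 ℳ)
    (hF : ∀ i a, F.shift i a ≤ i) (k : ℕ) :
    (∀ i h, RegLE 𝒜 k (i + 2) (LinearMap.ker (F.d i))
      ((ModuleGrading.free 𝒜 (F.shift (i + 1))).sub _ h)) ∧
    ∀ h, RegLE 𝒜 k 1 (LinearMap.ker F.aug) ((ModuleGrading.free 𝒜 (F.shift 0)).sub _ h) := by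
  have hd : ∀ i, IsHomogeneousMap (ModuleGrading.free 𝒜 (F.shift (i + 1)))
      (ModuleGrading.free 𝒜 (F.shift i)) (F.d i) := fun i => by
    have h1 : F.d i = Fintype.linearCombination R fun a => F.d i (Pi.single a 1) := by
      refine LinearMap.pi_ext' fun a => LinearMap.ext_ring ?_
      simp
    rw [h1]
    exact IsHomogeneousMap.linearCombination fun a =>
      ModuleGrading.mem_freePiece_iff.mp (F.d_mem i a)
  induction k with
  | zero => exact ⟨fun _ _ => trivial, fun _ => trivial⟩
  | succ k ih =>
    have key : ∀ i (N : Submodule R (Fin (F.rank i) → R))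
        (hN : (ModuleGrading.free 𝒜 (F.shift i)).Homogeneous N), LinearMap.range (F.d i) = N →
        RegLE 𝒜 (k + 1) (i + 1) N ((ModuleGrading.free 𝒜 (F.shift i)).sub N hN) := by
      rintro i _ hN rfl
      refine ⟨Fin (F.rank (i + 1)), inferInstance, F.shift (i + 1), (F.d i).rangeRestrict,
        (hd i).codRestrict _ _ _, hF (i + 1), LinearMap.surjective_rangeRestrict _, ?_⟩
      refine (ih.1 i (hd i).homogeneous_ker).of_equiv
        (LinearEquiv.ofEq _ _ (LinearMap.ker_rangeRestrict _).symm) fun j x => Subtype.ext rfl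
    exact ⟨fun i h => key (i + 1) _ h (LinearMap.exact_iff.mp (F.exact_succ i)).symm,
      fun h => key 0 _ h (LinearMap.exact_iff.mp F.exact_zero).symm⟩

/-- 𝔪 is the first syzygy module of the residue field; the minimal resolution of R/𝔪 starting with R
→ R/𝔪 has its i-th term generated in degrees at most i. -/
theorem IsKoszul.regLE_maxIdeal [Nontrivial R] (hR : IsStandardGraded 𝒜) (hK : IsKoszul 𝒜)
    (k : ℕ) : RegLE 𝒜 k 1 (maxIdeal 𝒜)
      ((ModuleGrading.self 𝒜).sub _ (homogeneous_maxIdeal 𝒜)) := by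
  have := hR.isNoetherianRing
  let aug : (Fin 1 → R) →ₗ[R] R ⧸ maxIdeal 𝒜 := (maxIdeal 𝒜).mkQ ∘ₗ LinearMap.proj 0
  have haug : ∀ x, x ∈ LinearMap.ker aug ↔ x 0 ∈ maxIdeal 𝒜 := fun x =>
    Submodule.Quotient.mk_eq_zero _
  -- The resolution returned by `exists_resolution` has an unspecified augmentation. The implication
  -- stored for i = 0 carries along the isomorphism between ker `aug` and 𝔪.
  let Φ : ∀ (_ n : ℕ) (_ : Fin n → ℕ), Submodule R (Fin n → R) → Prop := fun i n s N =>
    N ≤ maxIdeal 𝒜 • (⊤ : Submodule R (Fin n → R)) ∧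
    ∃ h : (ModuleGrading.free 𝒜 s).Homogeneous N, i = 0 →
      RegLE 𝒜 k 1 N ((ModuleGrading.free 𝒜 s).sub N h) →
      RegLE 𝒜 k 1 (maxIdeal 𝒜) ((ModuleGrading.self 𝒜).sub _ (homogeneous_maxIdeal 𝒜))
  obtain ⟨F, ⟨h0, hhom, hreg⟩, hF⟩ := exists_resolution (𝒜 := 𝒜)
    (ℳ := residueGrading 𝒜) Φ (by
      rintro i n s N ⟨hN, h, -⟩
      obtain ⟨ι, _, s', v, hv, hspan⟩ :=
        exists_homogeneous_generators ((ModuleGrading.free 𝒜 s).sub N h)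
      obtain ⟨m, s'', π, hπ, hsurj, hker, -⟩ :=
        exists_minimal_cover hR (fun _ => True) hv (fun _ => trivial) hspan
      have hd := (IsHomogeneousMap.subtype (ModuleGrading.free 𝒜 s) N h).comp hπ
      refine ⟨m, s'', N.subtype ∘ₗ π, hd, ?_, ?_, hd.homogeneous_ker, ?_⟩
      · rw [LinearMap.range_comp, LinearMap.range_eq_top.mpr hsurj, Submodule.map_top,
          Submodule.range_subtype]
      · rwa [LinearMap.ker_comp, Submodule.ker_subtype]
      · intro h
        omega) (n := 1) (s := 0) aug (fun a => by
      rw [Subsingleton.elim a 0]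
      exact ⟨1, ModuleGrading.one_mem_zero, by simp [aug]⟩) (fun y => by
      obtain ⟨x, rfl⟩ := (maxIdeal 𝒜).mkQ_surjective y
      exact ⟨fun _ => x, rfl⟩) (by
      have hh : (ModuleGrading.free 𝒜 (0 : Fin 1 → ℕ)).Homogeneous (LinearMap.ker aug) := by
        intro i x hx
        rw [haug] at *
        exact homogeneous_maxIdeal 𝒜 i _ hx
      refine ⟨fun x hx => mem_maxIdeal_smul_top.mpr fun a => ?_, hh, fun _ h => ?_⟩
      · rw [Subsingleton.elim a 0]
        exact (haug x).mp hx
      · let e : LinearMap.ker aug ≃ₗ[R] maxIdeal 𝒜 :=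
          { toFun := fun x => ⟨x.1 0, (haug x.1).mp x.2⟩
            invFun := fun y => ⟨fun _ => y, (haug _).mpr y.2⟩
            map_add' := fun _ _ => rfl
            map_smul' := fun _ _ => rfl
            left_inv := fun x => Subtype.ext (funext fun a => by rw [Subsingleton.elim a 0])
            right_inv := fun y => rfl }
        exact h.of_equiv e fun i x => Subtype.ext rfl)
  refine hreg rfl ((F.regLE_ker (fun i a => F.shift_le_of_reg (fun i => ?_) ?_ i a) k).2 hhom)
  · cases i with
    | zero => rw [← LinearMap.exact_iff.mp F.exact_zero]; exact h0
    | succ i => rw [← LinearMap.exact_iff.mp (F.exact_succ i)]; exact (hF i).1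
  · exact le_of_eq hK

variable {M : Type u} [AddCommGroup M] [Module R M] {g : ModuleGrading 𝒜 M}

theorem smul_eq_zero_of_concentrated {e : ℕ} (h : ∀ j, j ≠ e → ∀ x, g.proj j x = 0) {r : R}
    (hr : r ∈ maxIdeal 𝒜) (x : M) : r • x = 0 := by
  have hx : g.proj e x = x := g.ext_proj fun j => by
    rw [g.proj_proj]
    split_ifs with hj
    · rw [hj]
    · rw [h j hj]
  refine g.eq_zero _ fun j => ?_
  by_cases hj : j = e
  · subst hj
    rw [g.proj_smul_homogeneous hx, if_pos le_rfl, Nat.sub_self, mem_maxIdeal_iff.mp hr, zero_smul]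
  · exact h j hj _

/-- Over a Koszul algebra, finite direct sums of copies of `K(-e)` have regularity at most `e`. -/
theorem regLE_of_concentrated [Nontrivial R] [Module.Finite R M] (hR : IsStandardGraded 𝒜)
    (hm : ∀ k, RegLE 𝒜 k 1 (maxIdeal 𝒜) ((ModuleGrading.self 𝒜).sub _ (homogeneous_maxIdeal 𝒜)))
    {e : ℕ} (h : ∀ j, j ≠ e → ∀ x, g.proj j x = 0) (k : ℕ) : RegLE 𝒜 k e M g := by
  obtain ⟨ι, _, s', v, hv, hspan⟩ := exists_homogeneous_generators g
  obtain ⟨m, s, π, hπ, hsurj, hker, hs⟩ :=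
    exists_minimal_cover hR (fun _ => True) hv (fun _ => trivial) hspan
  have hs' : s = fun _ => e := funext fun a => by
    obtain ⟨x, hx0, hx⟩ := (hs a).2
    by_contra hne
    exact hx0 (by rw [← hx, h _ hne])
  subst hs'
  -- As 𝔪 annihilates M, the kernel of a minimal cover by copies of R(-e) is a direct sum of copies
  -- of 𝔪, shifted by e.
  have hker' : ∀ x, x ∈ LinearMap.ker π ↔ ∀ a, x a ∈ maxIdeal 𝒜 := fun x => by
    refine ⟨fun hx => mem_maxIdeal_smul_top.mp (hker hx), fun hx => ?_⟩
    rw [LinearMap.mem_ker, pi_eq_sum_univ' x, map_sum]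
    refine Finset.sum_eq_zero fun a _ => ?_
    rw [map_smul, smul_eq_zero_of_concentrated h (hx a)]
  cases k with
  | zero => trivial
  | succ k =>
    refine ⟨Fin m, inferInstance, _, π, hπ, fun _ => le_rfl, hsurj, ?_⟩
    let E : (Fin m → maxIdeal 𝒜) ≃ₗ[R] LinearMap.ker π :=
      { toFun := fun y => ⟨fun a => y a, (hker' _).mpr fun a => (y a).2⟩
        invFun := fun x a => ⟨x.1 a, (hker' _).mp x.2 a⟩
        map_add' := fun _ _ => rfl
        map_smul' := fun _ _ => rfl
        left_inv := fun _ => rfl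
        right_inv := fun _ => rfl }
    have := (hm k).pi (ι := Fin m) e
    rw [Nat.add_comm] at this
    refine this.of_equiv E fun i x => Subtype.ext (funext fun a => ?_)
    change (((((ModuleGrading.self 𝒜).sub _ (homogeneous_maxIdeal 𝒜)).pi fun _ => e).proj i x a :
      maxIdeal 𝒜) : R) = ((ModuleGrading.self 𝒜).pi fun _ => e).proj i (fun a => (x a : R)) a
    rw [ModuleGrading.pi_proj_apply, ModuleGrading.pi_proj_apply]
    split_ifs <;> rfl

theorem RegLE.finite {k d : ℕ} (h : RegLE 𝒜 (k + 1) d M g) : Module.Finite R M := by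
  obtain ⟨ι, _, s, π, -, -, hsurj, -⟩ := h
  exact Module.Finite.of_surjective π hsurj

/-- The quotient M / M_{≥e+1} is concentrated in degree e, hence has regularity at most e by
Koszulness, and `RegLE.of_shortExact` bounds the truncation. -/
theorem RegLE.trunc_succ [Nontrivial R] (hR : IsStandardGraded 𝒜)
    (hm : ∀ k, RegLE 𝒜 k 1 (maxIdeal 𝒜) ((ModuleGrading.self 𝒜).sub _ (homogeneous_maxIdeal 𝒜)))
    {e : ℕ} (h : ∀ k, RegLE 𝒜 k (e + 1) M g) (h0 : ∀ x, ∀ j < e, g.proj j x = 0) (k : ℕ) :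
    RegLE 𝒜 k (e + 1) (g.trunc (e + 1)) (g.sub _ (g.homogeneous_trunc _)) := by
  have := (h 1).finite
  have hmk := IsHomogeneousMap.mkQ g _ (g.homogeneous_trunc (e + 1))
  refine RegLE.of_shortExact (f := (g.trunc (e + 1)).subtype) (p := (g.trunc (e + 1)).mkQ)
    ⟨Subtype.val_injective, LinearMap.exact_subtype_mkQ _, Submodule.mkQ_surjective _,
      IsHomogeneousMap.subtype _ _ _, hmk⟩ (h k)
    (regLE_of_concentrated hR hm (fun j hj x => ?_) (k + 1))
  obtain ⟨x, rfl⟩ := Submodule.mkQ_surjective _ x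
  rw [← hmk, Submodule.mkQ_apply, Submodule.Quotient.mk_eq_zero]
  by_cases hlt : j < e
  · rw [h0 x j hlt]
    exact Submodule.zero_mem _
  · exact g.mem_trunc_of_homogeneous (g.proj_self _ _) (by omega)

/-- One degree is cut off at a time; each truncation starts in the degree required by
`RegLE.trunc_succ`. -/
theorem RegLE.trunc_add [Nontrivial R] (hR : IsStandardGraded 𝒜)
    (hm : ∀ k, RegLE 𝒜 k 1 (maxIdeal 𝒜) ((ModuleGrading.self 𝒜).sub _ (homogeneous_maxIdeal 𝒜)))
    {d : ℕ} (h : ∀ k, RegLE 𝒜 k d M g) (h0 : ∀ x, ∀ j < d, g.proj j x = 0) (c : ℕ) :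
    ∀ k, RegLE 𝒜 k (d + c) (g.trunc (d + c)) (g.sub _ (g.homogeneous_trunc _)) := by
  induction c with
  | zero =>
    intro k
    exact (h k).of_equiv (LinearEquiv.ofTop (g.trunc (d + 0)) (eq_top_iff.mpr fun x _ => h0 x)).symm
      fun i x => Subtype.ext rfl
  | succ c ih =>
    intro k
    have h1 := RegLE.trunc_succ hR hm (fun k => (ih k).mono (Nat.le_succ _))
      (fun x j hj => Subtype.ext (x.2 j hj)) k
    have hle : g.trunc (d + (c + 1)) ≤ g.trunc (d + c) := fun x hx j hj => hx j (by omega)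
    let e : (g.sub _ (g.homogeneous_trunc (d + c))).trunc (d + c + 1) ≃ₗ[R]
        g.trunc (d + (c + 1)) :=
      { toFun := fun x => ⟨x.1.1, fun j hj => congrArg Subtype.val (x.2 j hj)⟩
        invFun := fun y => ⟨⟨y.1, hle y.2⟩, fun j hj => Subtype.ext (y.2 j hj)⟩
        map_add' := fun _ _ => rfl
        map_smul' := fun _ _ => rfl
        left_inv := fun _ => rfl
        right_inv := fun _ => rfl }
    exact h1.of_equiv e fun i x => rfl

/-- A module of regularity at most `d` living in degrees at least `d` has a `d`-linear
resolution. -/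
theorem hasLinearResolution_of_regLE [Nontrivial R] [Module K M] (hR : IsStandardGraded 𝒜)
    {ℳ : ℕ → Submodule K M} {d : ℕ} (h : ∀ k, RegLE 𝒜 k d M g)
    (h0 : ∀ x, ∀ j < d, g.proj j x = 0) (hℳ : ∀ x, g.proj d x = x → x ∈ ℳ d) :
    HasLinearResolution 𝒜 ℳ d := by
  -- Containment in 𝔪F pushes N into degrees at least d + i + 1. This equals the bound on its
  -- regularity, so the next minimal cover is again generated in a single degree.
  let Φ : ∀ (_ n : ℕ) (_ : Fin n → ℕ), Submodule R (Fin n → R) → Prop := fun i n s N =>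
    (∀ a, s a = d + i) ∧ ∃ hN : (ModuleGrading.free 𝒜 s).Homogeneous N,
      (∀ k, RegLE 𝒜 k (d + i + 1) N ((ModuleGrading.free 𝒜 s).sub N hN)) ∧
      N ≤ maxIdeal 𝒜 • (⊤ : Submodule R (Fin n → R))
  have cover : ∀ {M : Type u} [AddCommGroup M] [Module R M] {g : ModuleGrading 𝒜 M} (d : ℕ),
      (∀ k, RegLE 𝒜 k d M g) → (∀ x, ∀ j < d, g.proj j x = 0) →
      ∃ (m : ℕ) (s : Fin m → ℕ) (π : (Fin m → R) →ₗ[R] M)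
        (hπ : IsHomogeneousMap (ModuleGrading.free 𝒜 s) g π), Function.Surjective π ∧
        (∀ a, s a = d) ∧ LinearMap.ker π ≤ maxIdeal 𝒜 • (⊤ : Submodule R (Fin m → R)) ∧
        ∀ k, RegLE 𝒜 k (d + 1) (LinearMap.ker π)
          ((ModuleGrading.free 𝒜 s).sub _ hπ.homogeneous_ker) := by
    intro M _ _ g d h h0
    obtain ⟨m, s, π, hπ, hsurj, hker, hs⟩ := exists_minimal_cover_of_regLE hR (h 1)
    refine ⟨m, s, π, hπ, hsurj, fun a => le_antisymm (hs a).1 ?_, hker, fun k => ?_⟩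
    · obtain ⟨x, hx0, hx⟩ := (hs a).2
      by_contra hlt
      exact hx0 (by rw [← hx, h0 x _ (not_le.mp hlt)])
    · exact RegLE.of_shortExact (.of_surjective hπ hsurj)
        (RegLE.free (fun a => (hs a).1.trans (Nat.le_succ d)) k) (h (k + 1))
  obtain ⟨m, s, π, hπ, hsurj, hs, hker, hreg⟩ := cover d h h0
  obtain ⟨F, hF0, hF⟩ := exists_resolution (𝒜 := 𝒜) (ℳ := ℳ) Φ (by
    rintro i n s N ⟨hs, hN, hreg, hle⟩
    obtain ⟨m, s', π, hπ, hsurj, hs', hker, hreg'⟩ := cover (d + i + 1) hreg (fun x j hj => by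
      apply Subtype.ext
      ext a
      rw [ModuleGrading.coe_sub_proj, ModuleGrading.pi_proj_apply, hs]
      split_ifs with hji
      -- The only degree left is j = d + i, where the component is the degree 0 part of a coordinate
      -- lying in 𝔪.
      · rw [Nat.le_antisymm hji (by omega), Nat.sub_self]
        exact mem_maxIdeal_iff.mp (mem_maxIdeal_smul_top.mp (hle x.2) a)
      · rfl)
    have hd := (IsHomogeneousMap.subtype (ModuleGrading.free 𝒜 s) N hN).comp hπ
    refine ⟨m, s', N.subtype ∘ₗ π, hd, ?_, hs', hd.homogeneous_ker, fun k => ?_, ?_⟩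
    · rw [LinearMap.range_comp, LinearMap.range_eq_top.mpr hsurj, Submodule.map_top,
        Submodule.range_subtype]
    · refine (hreg' k).of_equiv (LinearEquiv.ofEq _ _ ?_) fun _ _ => Subtype.ext rfl
      rw [LinearMap.ker_comp, Submodule.ker_subtype]
      rfl
    · rwa [LinearMap.ker_comp, Submodule.ker_subtype]) π
    (fun a => by
      rw [hs a]
      apply hℳ
      rw [← hπ, ← hs a, ModuleGrading.free_single]) hsurj
    ⟨hs, hπ.homogeneous_ker, hreg, hker⟩
  refine ⟨F, fun i => ?_⟩
  cases i with
  | zero => exact hF0.1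
  | succ i => exact (hF i).1

end KoszulAlgebras

/-! ### Relations with coefficients in the generators of 𝔪^c -/

section Relations

variable {K : Type w} {R : Type u} [Field K] [CommRing R] [Algebra K R]
  {𝒜 : ℕ → Submodule K R} [GradedAlgebra 𝒜]

/-- R is spanned over K by products of linear forms, and a product of k of them lies both in degree
k and in 𝔪^k. Hence the degree i component of any element is in 𝔪^i. -/
theorem IsStandardGraded.mem_maxIdeal_pow (hR : IsStandardGraded 𝒜) {c i : ℕ} (hci : c ≤ i) {r : R}
    (hr : r ∈ 𝒜 i) : r ∈ maxIdeal 𝒜 ^ c := by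
  refine Ideal.pow_le_pow_right hci ?_
  have h1 : ∀ y ∈ Submonoid.closure (𝒜 1 : Set R), ∃ k, y ∈ 𝒜 k ∧ y ∈ maxIdeal 𝒜 ^ k := by
    intro y hy
    induction hy using Submonoid.closure_induction with
    | mem y hy =>
      refine ⟨1, hy, ?_⟩
      rw [pow_one]
      exact HomogeneousIdeal.mem_irrelevant_of_mem 𝒜 one_pos hy
    | one => exact ⟨0, ModuleGrading.one_mem_zero, by rw [pow_zero, Ideal.one_eq_top]; trivial⟩
    | mul x y _ _ hx hy =>
      obtain ⟨k, hk, hk'⟩ := hx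
      obtain ⟨l, hl, hl'⟩ := hy
      exact ⟨k + l, SetLike.mul_mem_graded hk hl, by
        rw [pow_add]; exact Ideal.mul_mem_mul hk' hl'⟩
  have h2 : ∀ x ∈ Submodule.span K (Submonoid.closure (𝒜 1 : Set R) : Set R),
      ∀ i, GradedRing.proj 𝒜 i x ∈ maxIdeal 𝒜 ^ i := by
    intro x hx
    induction hx using Submodule.span_induction with
    | mem x hx =>
      obtain ⟨k, hk, hk'⟩ := h1 x hx
      intro i
      by_cases hik : i = k
      · subst hik
        rwa [← ModuleGrading.self_proj, ModuleGrading.self_proj_eq_self_iff.mpr hk]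
      · rw [← ModuleGrading.self_proj, ModuleGrading.proj_eq_zero_of_ne _ hik
          (ModuleGrading.self_proj_eq_self_iff.mpr hk)]
        exact Ideal.zero_mem _
    | zero => intro i; rw [map_zero]; exact Ideal.zero_mem _
    | add x y _ _ hx hy => intro i; rw [map_add]; exact Ideal.add_mem _ (hx i) (hy i)
    | smul k x _ hx =>
      intro i
      have : GradedRing.proj 𝒜 i (k • x) = k • GradedRing.proj 𝒜 i x :=
        map_smul (GradedAlgebra.proj 𝒜 i) k x
      rw [this, Algebra.smul_def]
      exact Ideal.mul_mem_left _ _ (hx i)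
  have h3 : r ∈ Submodule.span K (Submonoid.closure (𝒜 1 : Set R) : Set R) := by
    rw [← Algebra.adjoin_eq_span, hR.adjoin_one]
    trivial
  have h4 := h2 r h3 i
  rwa [← ModuleGrading.self_proj, ModuleGrading.self_proj_eq_self_iff.mpr hr] at h4

theorem ModuleGrading.smul_mem_trunc_succ {M : Type u} [AddCommGroup M] [Module R M]
    (g : ModuleGrading 𝒜 M) {N : ℕ} {r : R} (hr : r ∈ maxIdeal 𝒜) {x : M} (hx : x ∈ g.trunc N) :
    r • x ∈ g.trunc (N + 1) := by
  intro j hj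
  obtain ⟨n, hn⟩ := (ModuleGrading.self 𝒜).sum_proj r
  rw [← hn, Finset.sum_smul, map_sum]
  refine Finset.sum_eq_zero fun l _ => ?_
  rw [g.proj_smul_mem (show (ModuleGrading.self 𝒜).proj l r ∈ 𝒜 l from proj_mem r l)]
  split_ifs with hl
  · by_cases hl0 : l = 0
    · subst hl0
      rw [ModuleGrading.self_proj, mem_maxIdeal_iff.mp hr, zero_smul]
    · rw [hx _ (by omega), smul_zero]
  · rfl

theorem maxIdeal_pow_le_trunc (c : ℕ) : maxIdeal 𝒜 ^ c ≤ (ModuleGrading.self 𝒜).trunc c := by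
  induction c with
  | zero => exact fun x _ j hj => absurd hj (Nat.not_lt_zero j)
  | succ c ih =>
    rw [pow_succ', Ideal.mul_le]
    exact fun r hr t ht => ModuleGrading.smul_mem_trunc_succ _ hr (ih ht)

variable {n : ℕ} {M : Type u} [AddCommGroup M] [Module R M] {g : ModuleGrading 𝒜 M}

/-- The map `M^n → M` with `z ↦ ∑ a, u a • z a`. -/
noncomputable def relationMap (u : Fin n → R) (M : Type u) [AddCommGroup M] [Module R M] :
    (Fin n → M) →ₗ[R] M := ∑ a, u a • LinearMap.proj a

theorem relationMap_apply (u : Fin n → R) (z : Fin n → M) :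
    relationMap u M z = ∑ a, u a • z a := by
  simp [relationMap]

variable {c d : ℕ} {u : Fin n → R}

omit [GradedAlgebra 𝒜] in
theorem isHomogeneousMap_relationMap (hu : ∀ a, u a ∈ 𝒜 c) (g : ModuleGrading 𝒜 M) :
    IsHomogeneousMap (g.pi fun _ => c) g (relationMap u M) := fun i z => by
  rw [relationMap_apply, relationMap_apply, map_sum]
  refine Finset.sum_congr rfl fun a _ => ?_
  rw [g.proj_smul_mem (hu a), ModuleGrading.pi_proj_apply]
  split_ifs
  · rfl
  · exact smul_zero _

/-- The image is 𝔪^c M, and for M generated in degree d this is the whole of M in degrees at least d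
+ c. -/
theorem range_relationMap (hR : IsStandardGraded 𝒜) (hu : ∀ a, u a ∈ 𝒜 c)
    (hrange : LinearMap.range (koszulForm u) = maxIdeal 𝒜 ^ c)
    (h : RegLE 𝒜 1 d M g) (h0 : ∀ x, ∀ j < d, g.proj j x = 0) :
    LinearMap.range (relationMap u M) = g.trunc (d + c) := by
  classical
  refine le_antisymm ?_ fun y hy => ?_
  · rintro _ ⟨z, rfl⟩ j hj
    have hz : (g.pi fun _ => c).proj j z = 0 := by
      ext a
      rw [ModuleGrading.pi_proj_apply]
      split_ifs with hcj
      · exact h0 _ _ (by omega)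
      · rfl
    rw [← isHomogeneousMap_relationMap hu g, hz, map_zero]
  · have key : ∀ r ∈ maxIdeal 𝒜 ^ c, ∀ v : M, r • v ∈ LinearMap.range (relationMap u M) := by
      intro r hr v
      rw [← hrange] at hr
      obtain ⟨x, rfl⟩ := hr
      refine ⟨fun a => x a • v, ?_⟩
      rw [relationMap_apply, koszulForm, Fintype.linearCombination_apply, Finset.sum_smul]
      exact Finset.sum_congr rfl fun a _ => by rw [smul_smul, smul_eq_mul, mul_comm]
    obtain ⟨ι, _, s, π, hπ, hs, hsurj, -⟩ := h
    obtain ⟨x, rfl⟩ := hsurj y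
    refine g.mem_of_proj_mem _ fun j => ?_
    by_cases hj : j < d + c
    · rw [hy j hj]
      exact Submodule.zero_mem _
    -- In degree j ≥ d + c, a generator of degree at most d has a coefficient of degree at least c,
    -- which lies in 𝔪^c.
    · rw [← hπ, pi_eq_sum_univ' ((ModuleGrading.free 𝒜 s).proj j x), map_sum]
      refine Submodule.sum_mem _ fun a _ => ?_
      rw [map_smul, ModuleGrading.pi_proj_apply]
      have := hs a
      rw [if_pos (by omega)]
      exact key _ (hR.mem_maxIdeal_pow (by omega) (proj_mem _ _)) _

/-- The relations `∑ u a • z a = 0` of degree at least `N`, for `u a` of degree `c`. -/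
noncomputable def relationModule (u : Fin n → R) (g : ModuleGrading 𝒜 M) (c N : ℕ) :
    Submodule R (Fin n → M) :=
  LinearMap.ker (relationMap u M) ⊓ (g.pi fun _ => c).trunc N

theorem mem_relationModule {N : ℕ} {z : Fin n → M} : z ∈ relationModule u g c N ↔
    relationMap u M z = 0 ∧ ∀ j < N, (g.pi fun _ => c).proj j z = 0 := Iff.rfl

theorem homogeneous_relationModule (hu : ∀ a, u a ∈ 𝒜 c) (g : ModuleGrading 𝒜 M) (N : ℕ) :
    (g.pi fun _ => c).Homogeneous (relationModule u g c N) := fun i x hx =>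
  ⟨(isHomogeneousMap_relationMap hu g).homogeneous_ker i x hx.1,
    ModuleGrading.homogeneous_trunc _ _ i x hx.2⟩

/-- If `M` has a `d`-linear resolution over a Koszul algebra, the relations `∑ u a • z a = 0` of
degree at least `d + c + 1` form a module with a linear resolution. -/
theorem RegLE.relations [Nontrivial R] (hR : IsStandardGraded 𝒜)
    (hm : ∀ k, RegLE 𝒜 k 1 (maxIdeal 𝒜) ((ModuleGrading.self 𝒜).sub _ (homogeneous_maxIdeal 𝒜)))
    (hu : ∀ a, u a ∈ 𝒜 c) (hrange : LinearMap.range (koszulForm u) = maxIdeal 𝒜 ^ c)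
    (h : ∀ k, RegLE 𝒜 k d M g) (h0 : ∀ x, ∀ j < d, g.proj j x = 0) (k : ℕ) :
    RegLE 𝒜 k (d + c + 1) (relationModule u g c (d + c + 1))
      ((g.pi fun _ => c).sub _ (homogeneous_relationModule hu g (d + c + 1))) := by
  have hψ := isHomogeneousMap_relationMap hu g
  have hr := range_relationMap hR hu hrange (h 1) h0
  have hmem : ∀ z, relationMap u M z ∈ g.trunc (d + c) := fun z => hr ▸ ⟨z, rfl⟩
  let e : ((g.pi fun _ => c).sub _ hψ.homogeneous_ker).trunc (d + c + 1) ≃ₗ[R]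
      relationModule u g c (d + c + 1) :=
    { toFun := fun x => ⟨x.1.1, x.1.2, fun j hj => congrArg Subtype.val (x.2 j hj)⟩
      invFun := fun y => ⟨⟨y.1, y.2.1⟩, fun j hj => Subtype.ext (y.2.2 j hj)⟩
      map_add' := fun _ _ => rfl
      map_smul' := fun _ _ => rfl
      left_inv := fun _ => rfl
      right_inv := fun _ => rfl }
  refine RegLE.of_equiv (RegLE.trunc_succ hR hm (fun k => ?_)
    (fun x j hj => Subtype.ext (funext fun a => ?_)) k) e fun _ _ => rfl
  -- In 0 → ker → M(-c)^n → M_{≥d+c} → 0 the last two modules have regularity at most d + c, so the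
  -- kernel has regularity at most d + c + 1. It lives in degrees at least d + c, and one further
  -- truncation step gives the claim.
  · have hψ' := hψ.codRestrict _ (g.homogeneous_trunc (d + c)) hmem
    refine RegLE.of_shortExact (f := (LinearMap.ker (relationMap u M)).subtype)
      (p := (relationMap u M).codRestrict _ hmem) ⟨Subtype.val_injective, fun y => ?_, fun y => ?_,
        IsHomogeneousMap.subtype _ _ _, hψ'⟩
      (((h k).pi c).mono (Nat.le_succ _)) (RegLE.trunc_add hR hm h h0 c (k + 1))
    · refine ⟨fun hy => ⟨⟨y, congrArg Subtype.val hy⟩, rfl⟩, ?_⟩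
      rintro ⟨x, rfl⟩
      exact Subtype.ext x.2
    · obtain ⟨z, hz⟩ := hr.ge y.2
      exact ⟨z, Subtype.ext hz⟩
  · rw [ModuleGrading.coe_sub_proj, ModuleGrading.pi_proj_apply]
    split_ifs
    · exact h0 _ _ (by omega)
    · rfl

theorem IsHomogeneousMap.exists_lift_trunc {M' : Type u} [AddCommGroup M'] [Module R M']
    {g' : ModuleGrading 𝒜 M'} {π : M' →ₗ[R] M} (hπ : IsHomogeneousMap g' g π)
    (hsurj : Function.Surjective π) {N : ℕ} {x : M} (hx : x ∈ g.trunc N) :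
    ∃ y ∈ g'.trunc N, π y = x := by
  obtain ⟨y, rfl⟩ := hsurj x
  -- The components of degree below N of an arbitrary lift are killed by π and can be subtracted.
  refine ⟨y - ∑ i ∈ Finset.range N, g'.proj i y, fun j hj => ?_, ?_⟩
  · simp [g'.proj_proj, hj]
  · rw [map_sub, map_sum, Finset.sum_eq_zero, sub_zero]
    intro i hi
    rw [hπ, hx i (Finset.mem_range.mp hi)]

/-- Let F → M be a minimal cover with F generated in degree d, and let Q be its kernel, which is
generated in degree d + 1. Lift z to y in F_{≥d+1}. Then Σ u_a y_a lies in Q in degrees at least d +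
1 + c, so it equals Σ u_a q_a with q_a in Q by `range_relationMap`. The family y - q still lifts z
and is a relation in the free module F, so each of its coordinates is an element of ker φ. Raising
the degrees of the z_a above d is essential for placing the sum in 𝔪^c Q. -/
theorem mem_span_of_relation [Nontrivial R] (hR : IsStandardGraded 𝒜)
    (hu : ∀ a, u a ∈ 𝒜 c) (hrange : LinearMap.range (koszulForm u) = maxIdeal 𝒜 ^ c)
    (h : RegLE 𝒜 2 d M g) (h0 : ∀ x, ∀ j < d, g.proj j x = 0) {z : Fin n → M}
    (hz : relationMap u M z = 0) (hz' : ∀ a, z a ∈ g.trunc (d + 1)) :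
    ∃ (m : ℕ) (w : Fin m → Fin n → R) (y : Fin m → M), (∀ b, koszulForm u (w b) = 0) ∧
      ∀ a, z a = ∑ b, w b a • y b := by
  classical
  obtain ⟨m, s, π, hπ, hsurj, hker, hs⟩ := exists_minimal_cover_of_regLE hR h
  have hsd : ∀ a, s a = d := fun a => le_antisymm (hs a).1 (by
    obtain ⟨x, hx0, hx⟩ := (hs a).2
    by_contra hlt
    exact hx0 (by rw [← hx, h0 x _ (not_le.mp hlt)]))
  have hQ : RegLE 𝒜 1 (d + 1) _ ((ModuleGrading.free 𝒜 s).sub _ hπ.homogeneous_ker) :=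
    RegLE.of_shortExact (.of_surjective hπ hsurj)
      (RegLE.free (fun a => (hs a).1.trans (Nat.le_succ d)) 1) h
  have hQ0 : ∀ x, ∀ j < d + 1,
      ((ModuleGrading.free 𝒜 s).sub _ hπ.homogeneous_ker).proj j x = 0 := fun x j hj => by
    apply Subtype.ext
    ext a
    rw [ModuleGrading.coe_sub_proj, ModuleGrading.pi_proj_apply, hsd]
    split_ifs with hji
    · rw [Nat.le_antisymm hji (by omega), Nat.sub_self]
      exact mem_maxIdeal_iff.mp (mem_maxIdeal_smul_top.mp (hker x.2) a)
    · rfl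
  choose y hy hyz using fun a => hπ.exists_lift_trunc hsurj (hz' a)
  have hx : relationMap u _ y ∈ LinearMap.ker π := by
    rw [LinearMap.mem_ker, ← hz, relationMap_apply, relationMap_apply, map_sum]
    exact Finset.sum_congr rfl fun a _ => by rw [map_smul, hyz]
  have hx' : (⟨_, hx⟩ : LinearMap.ker π) ∈
      ((ModuleGrading.free 𝒜 s).sub _ hπ.homogeneous_ker).trunc (d + 1 + c) := by
    intro j hj
    apply Subtype.ext
    change (ModuleGrading.free 𝒜 s).proj j (relationMap u _ y) = 0
    rw [relationMap_apply, map_sum]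
    refine Finset.sum_eq_zero fun a _ => ?_
    rw [ModuleGrading.proj_smul_mem _ (hu a)]
    split_ifs
    · rw [hy a _ (by omega), smul_zero]
    · rfl
  rw [← range_relationMap hR hu hrange hQ hQ0] at hx'
  obtain ⟨q, hq⟩ := hx'
  have hq' : ∑ a, u a • (q a : Fin m → R) = ∑ a, u a • y a := by
    have h1 : ((relationMap u _ q : LinearMap.ker π) : Fin m → R) = relationMap u _ y :=
      congrArg Subtype.val hq
    rw [relationMap_apply, relationMap_apply] at h1
    simpa using h1
  -- For fixed b, the b-th coordinates of y - q form an element of ker φ; the accompanying elements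
  -- of M are the images of the basis of F.
  refine ⟨m, fun b a => (y a - q a) b, fun b => π (Pi.single b 1), fun b => ?_, fun a => ?_⟩
  · rw [koszulForm, Fintype.linearCombination_apply]
    have h1 := congrFun hq' b
    simp only [Finset.sum_apply, Pi.smul_apply, smul_eq_mul] at h1
    simp only [Pi.sub_apply, smul_eq_mul, sub_mul, Finset.sum_sub_distrib]
    rw [sub_eq_zero]
    simpa only [mul_comm] using h1.symm
  · have h2 : z a = π (y a - q a) := by
      rw [map_sub, hyz, show π (q a : Fin m → R) = 0 from (q a).2, sub_zero]
    rw [h2]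
    conv_lhs => rw [pi_eq_sum_univ' (y a - (q a : Fin m → R)), map_sum]
    exact Finset.sum_congr rfl fun b _ => map_smul _ _ _

/-- If deg a > c, then u_a ∈ 𝔪^{c+1} = φ(𝔪F), so e_a agrees modulo ker φ ⊆ 𝔪F with an element of 𝔪F.
If deg a < c, then u_a = 0 because 𝔪^c starts in degree c, so e_a ∈ ker φ. Either way e_a ∈ 𝔪F,
which is absurd. -/
theorem IsMinimalGenerators.deg_eq [Nontrivial R] (hR : IsStandardGraded 𝒜) {deg : Fin n → ℕ}
    (hu : IsMinimalGenerators 𝒜 (maxIdeal 𝒜 ^ c) deg u) (a : Fin n) : deg a = c := by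
  classical
  have hua : u a ∈ maxIdeal 𝒜 ^ c := hu.range_eq ▸ ⟨Pi.single a 1, by simp [koszulForm]⟩
  have hu' := ModuleGrading.self_proj_eq_self_iff.mpr (hu.mem a)
  refine le_antisymm ?_ ?_
  · by_contra hlt
    have h1 := hR.mem_maxIdeal_pow (not_le.mp hlt) (hu.mem a)
    rw [pow_succ', ← hu.range_eq, ← smul_eq_mul, LinearMap.range_eq_map,
      ← Submodule.map_smul''] at h1
    obtain ⟨x, hx, hxu⟩ := h1
    have h2 : Pi.single a 1 - x ∈ LinearMap.ker (koszulForm u) := by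
      rw [LinearMap.mem_ker, map_sub, hxu]
      simp [koszulForm]
    have h3 := Submodule.add_mem _ (hu.ker_le h2) hx
    rw [sub_add_cancel] at h3
    exact single_notMem_maxIdeal_smul_top a h3
  · by_contra hlt
    have h1 := maxIdeal_pow_le_trunc c hua (deg a) (not_le.mp hlt)
    rw [hu'] at h1
    refine single_notMem_maxIdeal_smul_top (𝒜 := 𝒜) a (hu.ker_le ?_)
    simp [koszulForm, h1]

end Relations

/-! ### Contractions and internal degrees in the exterior algebra -/

section Exterior

variable {R : Type u} [CommRing R] {n : ℕ}

/-- The basis of the exterior algebra of `R^n`. -/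
noncomputable def extBasis (R : Type u) [CommRing R] (n : ℕ) :
    Module.Basis (Finset (Fin n)) R (ExteriorAlgebra R (Fin n → R)) :=
  (Pi.basisFun R (Fin n)).ExteriorAlgebra

/-- The generator `e_a` of the exterior algebra of `R^n`. -/
noncomputable def extGen (R : Type u) [CommRing R] {n : ℕ} (a : Fin n) :
    ExteriorAlgebra R (Fin n → R) :=
  ExteriorAlgebra.ι R (Pi.single a 1)

/-- The contraction with the `a`-th coordinate form. -/
noncomputable def extContract (R : Type u) [CommRing R] {n : ℕ} (a : Fin n) :
    ExteriorAlgebra R (Fin n → R) →ₗ[R] ExteriorAlgebra R (Fin n → R) :=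
  CliffordAlgebra.contractLeft (Q := (0 : QuadraticForm R (Fin n → R))) (LinearMap.proj a)

theorem extContract_ι_mul (a : Fin n) (v : Fin n → R) (y : ExteriorAlgebra R (Fin n → R)) :
    extContract R a (ExteriorAlgebra.ι R v * y) =
      v a • y - ExteriorAlgebra.ι R v * extContract R a y :=
  CliffordAlgebra.contractLeft_ι_mul (Q := (0 : QuadraticForm R (Fin n → R))) _ v y

theorem extContract_one (a : Fin n) : extContract R a 1 = 0 :=
  CliffordAlgebra.contractLeft_one (Q := (0 : QuadraticForm R (Fin n → R))) _

theorem koszulDifferential_ι_mul (u : Fin n → R) (v : Fin n → R)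
    (y : ExteriorAlgebra R (Fin n → R)) :
    koszulDifferential u (ExteriorAlgebra.ι R v * y) =
      koszulForm u v • y - ExteriorAlgebra.ι R v * koszulDifferential u y :=
  CliffordAlgebra.contractLeft_ι_mul (Q := (0 : QuadraticForm R (Fin n → R))) _ v y

/-- Contractions with linear forms anticommute; consequently contractions of cycles are cycles. -/
theorem koszulDifferential_extContract (u : Fin n → R) (a : Fin n)
    (y : ExteriorAlgebra R (Fin n → R)) :
    koszulDifferential u (extContract R a y) = -extContract R a (koszulDifferential u y) :=
  CliffordAlgebra.contractLeft_comm (Q := (0 : QuadraticForm R (Fin n → R))) _ _ y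

theorem koszulForm_single (u : Fin n → R) (a : Fin n) : koszulForm u (Pi.single a 1) = u a := by
  simp [koszulForm]

theorem koszulDifferential_eq_sum (u : Fin n → R) (y : ExteriorAlgebra R (Fin n → R)) :
    koszulDifferential u y = ∑ a, u a • extContract R a y := by
  have h : koszulForm u = ∑ a, u a • (LinearMap.proj a : (Fin n → R) →ₗ[R] R) := by
    refine LinearMap.ext fun x => ?_
    simp [koszulForm, Fintype.linearCombination_apply, mul_comm]
  rw [koszulDifferential, h, map_sum, LinearMap.sum_apply]
  refine Finset.sum_congr rfl fun a _ => ?_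
  rw [map_smul]
  rfl

theorem ι_eq_sum (v : Fin n → R) : ExteriorAlgebra.ι R v = ∑ a, v a • extGen R a := by
  conv_lhs => rw [pi_eq_sum_univ' v, map_sum]
  exact Finset.sum_congr rfl fun a _ => map_smul _ _ _

theorem extContract_mem (a : Fin n) {t : ℕ} {y : ExteriorAlgebra R (Fin n → R)} :
    y ∈ ⋀[R]^(t + 1) (Fin n → R) → extContract R a y ∈ ⋀[R]^t (Fin n → R) := by
  induction t generalizing y with
  | zero =>
    intro hy
    rw [zero_add, ExteriorAlgebra.exteriorPower, pow_one] at hy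
    obtain ⟨v, rfl⟩ := hy
    rw [← mul_one (ExteriorAlgebra.ι R v), extContract_ι_mul, extContract_one, mul_zero, sub_zero]
    refine Submodule.smul_mem _ _ ?_
    rw [ExteriorAlgebra.exteriorPower, pow_zero]
    exact Submodule.one_le.mp le_rfl
  | succ t ih =>
    intro hy
    rw [ExteriorAlgebra.exteriorPower, pow_succ'] at hy
    refine Submodule.mul_induction_on hy ?_ fun x y hx hy => ?_
    · rintro _ ⟨v, rfl⟩ y hy
      rw [extContract_ι_mul]
      refine Submodule.sub_mem _ (Submodule.smul_mem _ _ hy) ?_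
      rw [ExteriorAlgebra.exteriorPower, pow_succ']
      exact Submodule.mul_mem_mul ⟨v, rfl⟩ (ih hy)
    · rw [map_add]
      exact Submodule.add_mem _ hx hy

/-- Euler's formula, by induction on t. Moving e_a past a vector v and contracting v contribute two
sign changes that cancel, so each factor of a product adds one copy of y. -/
theorem sum_extGen_mul_extContract {t : ℕ} {y : ExteriorAlgebra R (Fin n → R)} :
    y ∈ ⋀[R]^t (Fin n → R) → ∑ a, extGen R a * extContract R a y = (t : R) • y := by
  induction t generalizing y with
  | zero =>
    intro hy
    rw [ExteriorAlgebra.exteriorPower, pow_zero] at hy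
    obtain ⟨r, rfl⟩ := Submodule.mem_one.mp hy
    rw [Nat.cast_zero, zero_smul]
    refine Finset.sum_eq_zero fun a _ => ?_
    rw [Algebra.algebraMap_eq_smul_one, map_smul, extContract_one, smul_zero, mul_zero]
  | succ t ih =>
    intro hy
    rw [ExteriorAlgebra.exteriorPower, pow_succ'] at hy
    refine Submodule.mul_induction_on hy ?_ fun x y hx hy => ?_
    · rintro _ ⟨v, rfl⟩ y hy
      have h1 : ∀ a, extGen R a * extContract R a (ExteriorAlgebra.ι R v * y) =
          (v a • extGen R a) * y + ExteriorAlgebra.ι R v * (extGen R a * extContract R a y) := by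
        intro a
        have h2 : extGen R a * ExteriorAlgebra.ι R v = -(ExteriorAlgebra.ι R v * extGen R a) :=
          eq_neg_of_add_eq_zero_left (ExteriorAlgebra.ι_add_mul_swap _ _)
        rw [extContract_ι_mul, mul_sub, mul_smul_comm, smul_mul_assoc, ← mul_assoc, h2, neg_mul,
          sub_neg_eq_add, mul_assoc]
      rw [Finset.sum_congr rfl fun a _ => h1 a, Finset.sum_add_distrib, ← Finset.sum_mul,
        ← Finset.mul_sum, ← ι_eq_sum, ih hy, mul_smul_comm, Nat.cast_succ, add_smul, one_smul,
        add_comm]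
    · simp only [map_add, mul_add, Finset.sum_add_distrib, smul_add]
      rw [hx, hy]

variable {K : Type w} [Field K] [Algebra K R] {𝒜 : ℕ → Submodule K R} [GradedAlgebra 𝒜]

variable (𝒜) in
/-- The grading of the exterior algebra of `R^n` in which all the elements of the standard basis
have degree `s`. -/
noncomputable def extGrading (n s : ℕ) : ModuleGrading 𝒜 (ExteriorAlgebra R (Fin n → R)) :=
  (ModuleGrading.free 𝒜 fun _ : Finset (Fin n) => s).comapEquiv (extBasis R n).equivFun

/-- All these gradings are shifts of the grading by the degree of the coefficients, so homogeneity
need only be checked for s = 0. On ⋀^t, with all generators in degree c, the internal degree is the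
one with s = t * c. -/
theorem extGrading_proj (s j : ℕ) (x : ExteriorAlgebra R (Fin n → R)) :
    (extGrading 𝒜 n s).proj j x = if s ≤ j then (extGrading 𝒜 n 0).proj (j - s) x else 0 := by
  rw [extGrading, extGrading, ModuleGrading.comapEquiv_proj, ModuleGrading.comapEquiv_proj]
  split_ifs with h
  · congr 1
    ext S
    rw [ModuleGrading.pi_proj_apply, ModuleGrading.pi_proj_apply, if_pos h,
      if_pos (Nat.zero_le _), Nat.sub_zero]
  · convert map_zero (extBasis R n).equivFun.symm
    ext S
    rw [ModuleGrading.pi_proj_apply, if_neg h]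
    rfl

theorem isHomogeneousMap_extGrading
    {f : ExteriorAlgebra R (Fin n → R) →ₗ[R] ExteriorAlgebra R (Fin n → R)}
    (h : IsHomogeneousMap (extGrading 𝒜 n 0) (extGrading 𝒜 n 0) f) (s : ℕ) :
    IsHomogeneousMap (extGrading 𝒜 n s) (extGrading 𝒜 n s) f := fun i x => by
  rw [extGrading_proj s i x, extGrading_proj s i (f x)]
  split_ifs
  · exact h _ _
  · exact map_zero _

theorem extGrading_proj_basis (S : Finset (Fin n)) :
    (extGrading 𝒜 n 0).proj 0 (extBasis R n S) = extBasis R n S := by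
  classical
  have h : (extBasis R n).equivFun (extBasis R n S) = Pi.single S 1 := by
    ext T
    rw [Module.Basis.equivFun_self, Pi.single_apply]
    simp only [eq_comm]
  rw [extGrading, ModuleGrading.comapEquiv_proj, LinearEquiv.symm_apply_eq, h]
  exact ModuleGrading.free_single (fun _ : Finset (Fin n) => 0) S

theorem extGen_eq (a : Fin n) : extGen R a = extBasis R n {a} := by
  have h : ({a} : Finset (Fin n)).card = 1 := Finset.card_singleton a
  rw [extBasis, ExteriorAlgebra.basis_apply_ofCard _ h, ExteriorAlgebra.ιMulti_family,
    ExteriorAlgebra.ιMulti_succ_apply, ExteriorAlgebra.ιMulti_zero_apply, mul_one,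
    Function.comp_apply, Pi.basisFun_apply, extGen]
  have h1 : Set.powersetCard.ofFinEmbEquiv.symm (Set.powersetCard.ofCard h) 0 = a := by
    have := (Set.powersetCard.mem_range_ofFinEmbEquiv_symm_iff_mem
      (Set.powersetCard.ofCard h) (Set.powersetCard.ofFinEmbEquiv.symm
        (Set.powersetCard.ofCard h) 0)).mp ⟨0, rfl⟩
    exact Finset.mem_singleton.mp this
  rw [h1]

/-- A linear endomorphism preserving the elements with coefficients of degree `0` is homogeneous. -/
theorem proj_comm_of_basis {f : ExteriorAlgebra R (Fin n → R) →ₗ[R] ExteriorAlgebra R (Fin n → R)}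
    (hf : ∀ S, (extGrading 𝒜 n 0).proj 0 (f (extBasis R n S)) = f (extBasis R n S)) :
    IsHomogeneousMap (extGrading 𝒜 n 0) (extGrading 𝒜 n 0) f := by
  have h1 := IsHomogeneousMap.linearCombination (g := extGrading 𝒜 n 0)
    (s := fun _ : Finset (Fin n) => 0) hf
  have h2 : ∀ x, f x = Fintype.linearCombination R (fun S => f (extBasis R n S))
      ((extBasis R n).equivFun x) := by
    intro x
    conv_lhs => rw [← (extBasis R n).sum_equivFun x, map_sum]
    rw [Fintype.linearCombination_apply]
    exact Finset.sum_congr rfl fun S _ => map_smul _ _ _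
  intro i x
  rw [h2, h2, ← h1, extGrading, ModuleGrading.comapEquiv_proj, LinearEquiv.apply_symm_apply]

/-- The product of two basis elements is zero or a basis element up to sign. -/
theorem isHomogeneousMap_extGen_mul (a : Fin n) :
    IsHomogeneousMap (extGrading 𝒜 n 0) (extGrading 𝒜 n 0) (LinearMap.mulLeft R (extGen R a)) := by
  refine proj_comm_of_basis fun S => ?_
  rw [LinearMap.mulLeft_apply, extGen_eq]
  have h : ({a} : Finset (Fin n)).card = 1 := Finset.card_singleton a
  have e1 : ({a} : Finset (Fin n)) = (Set.powersetCard.ofCard h : Finset (Fin n)) := rfl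
  have e2 : S = (Set.powersetCard.ofCard (rfl : S.card = S.card) : Finset (Fin n)) := rfl
  rw [e1, e2, extBasis]
  by_cases hd : Disjoint (Set.powersetCard.ofCard h).val
      (Set.powersetCard.ofCard (rfl : S.card = S.card)).val
  · rw [ExteriorAlgebra.basis_mul_of_disjoint _ _ _ hd]
    obtain h1 | h1 := Int.units_eq_one_or
      (Equiv.Perm.sign (Set.powersetCard.permOfDisjoint hd)) <;> rw [h1]
    · rw [one_smul]
      exact extGrading_proj_basis _
    · rw [Units.neg_smul, one_smul, map_neg]
      exact congrArg Neg.neg (extGrading_proj_basis _)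
  · rw [ExteriorAlgebra.basis_mul_of_not_disjoint _ _ _ hd, map_zero]

theorem extGrading_proj_one : (extGrading 𝒜 n 0).proj 0 1 = 1 := by
  have h : (1 : ExteriorAlgebra R (Fin n → R)) = extBasis R n ∅ := by
    rw [extBasis, ExteriorAlgebra.basis_apply_ofCard _ Finset.card_empty,
      ExteriorAlgebra.ιMulti_family, ExteriorAlgebra.ιMulti_zero_apply]
  rw [h, extGrading_proj_basis]

theorem ιMulti_single_succ {t : ℕ} (v : Fin (t + 1) → Fin n) :
    ExteriorAlgebra.ιMulti R (t + 1) (fun k => (Pi.single (v k) 1 : Fin n → R)) =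
      extGen R (v 0) * ExteriorAlgebra.ιMulti R t
        (fun k => (Pi.single (v k.succ) 1 : Fin n → R)) :=
  ExteriorAlgebra.ιMulti_succ_apply _

theorem extGrading_proj_ιMulti {t : ℕ} (v : Fin t → Fin n) :
    (extGrading 𝒜 n 0).proj 0 (ExteriorAlgebra.ιMulti R t
      (fun k => (Pi.single (v k) 1 : Fin n → R))) =
      ExteriorAlgebra.ιMulti R t (fun k => (Pi.single (v k) 1 : Fin n → R)) := by
  induction t with
  | zero => rw [ExteriorAlgebra.ιMulti_zero_apply, extGrading_proj_one]
  | succ t ih =>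
    have := isHomogeneousMap_extGen_mul (𝒜 := 𝒜) (v 0) 0
      (ExteriorAlgebra.ιMulti R t (fun k => (Pi.single (v k.succ) 1 : Fin n → R)))
    rw [ih] at this
    rw [ιMulti_single_succ]
    exact this.symm

theorem extGrading_proj_extContract_ιMulti (a : Fin n) {t : ℕ} (v : Fin t → Fin n) :
    (extGrading 𝒜 n 0).proj 0 (extContract R a (ExteriorAlgebra.ιMulti R t
      (fun k => (Pi.single (v k) 1 : Fin n → R)))) =
      extContract R a (ExteriorAlgebra.ιMulti R t
        (fun k => (Pi.single (v k) 1 : Fin n → R))) := by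
  induction t with
  | zero => rw [ExteriorAlgebra.ιMulti_zero_apply, extContract_one, map_zero]
  | succ t ih =>
    have h1 := isHomogeneousMap_extGen_mul (𝒜 := 𝒜) (v 0) 0 (extContract R a
      (ExteriorAlgebra.ιMulti R t (fun k => (Pi.single (v k.succ) 1 : Fin n → R))))
    rw [ih] at h1
    rw [ιMulti_single_succ, extGen, extContract_ι_mul, map_sub]
    congr 1
    · by_cases h : a = v 0
      · rw [h, Pi.single_eq_same, one_smul, extGrading_proj_ιMulti]
      · rw [Pi.single_eq_of_ne h, zero_smul, map_zero]
    · exact h1.symm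

theorem extBasis_eq_ιMulti (S : Finset (Fin n)) :
    ∃ v : Fin S.card → Fin n, extBasis R n S =
      ExteriorAlgebra.ιMulti R S.card (fun k => (Pi.single (v k) 1 : Fin n → R)) := by
  refine ⟨Set.powersetCard.ofFinEmbEquiv.symm (Set.powersetCard.ofCard rfl),
    (ExteriorAlgebra.basis_apply_ofCard _ rfl).trans ?_⟩
  rw [ExteriorAlgebra.ιMulti_family]
  congr 1
  funext k
  exact Pi.basisFun_apply _ _ _

theorem isHomogeneousMap_extContract (a : Fin n) :
    IsHomogeneousMap (extGrading 𝒜 n 0) (extGrading 𝒜 n 0) (extContract R a) :=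
  proj_comm_of_basis fun S => by
    obtain ⟨v, hv⟩ := extBasis_eq_ιMulti (R := R) S
    rw [hv, extGrading_proj_extContract_ιMulti]

theorem exists_sum_ιMulti {t : ℕ} {x : ExteriorAlgebra R (Fin n → R)}
    (hx : x ∈ ⋀[R]^t (Fin n → R)) :
    ∃ (r : Set.powersetCard (Fin n) t → R) (v : Set.powersetCard (Fin n) t → Fin t → Fin n),
      x = ∑ S, r S • ExteriorAlgebra.ιMulti R t
        (fun k => (Pi.single (v S k) 1 : Fin n → R)) := by
  let B := (Pi.basisFun R (Fin n)).exteriorPower t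
  refine ⟨fun S => B.equivFun ⟨x, hx⟩ S, fun S => Set.powersetCard.ofFinEmbEquiv.symm S, ?_⟩
  have h := congrArg Subtype.val (B.sum_equivFun ⟨x, hx⟩)
  rw [Submodule.coe_sum] at h
  refine h.symm.trans ?_
  refine Finset.sum_congr rfl fun S _ => ?_
  rw [Submodule.coe_smul]
  congr 1
  rw [exteriorPower.basis_apply, exteriorPower.ιMulti_family_apply_coe,
    ExteriorAlgebra.ιMulti_family]
  congr 1
  funext k
  exact Pi.basisFun_apply R (Fin n) _

theorem extGrading_proj_sum {t : ℕ} (r : Set.powersetCard (Fin n) t → R)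
    (v : Set.powersetCard (Fin n) t → Fin t → Fin n) (i : ℕ) :
    (extGrading 𝒜 n 0).proj i (∑ S, r S • ExteriorAlgebra.ιMulti R t
        (fun k => (Pi.single (v S k) 1 : Fin n → R))) =
      ∑ S, GradedRing.proj 𝒜 i (r S) • ExteriorAlgebra.ιMulti R t
        (fun k => (Pi.single (v S k) 1 : Fin n → R)) := by
  rw [map_sum]
  refine Finset.sum_congr rfl fun S _ => ?_
  rw [ModuleGrading.proj_smul_homogeneous _ (extGrading_proj_ιMulti _), if_pos (Nat.zero_le _),
    Nat.sub_zero]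

theorem ιMulti_single_mem {t : ℕ} (v : Fin t → Fin n) :
    ExteriorAlgebra.ιMulti R t (fun k => (Pi.single (v k) 1 : Fin n → R)) ∈
      ⋀[R]^t (Fin n → R) := ExteriorAlgebra.ιMulti_range R t ⟨_, rfl⟩

theorem extGrading_proj_mem {t : ℕ} (i : ℕ) {x : ExteriorAlgebra R (Fin n → R)}
    (hx : x ∈ ⋀[R]^t (Fin n → R)) : (extGrading 𝒜 n 0).proj i x ∈ ⋀[R]^t (Fin n → R) := by
  obtain ⟨r, v, rfl⟩ := exists_sum_ιMulti hx
  rw [extGrading_proj_sum]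
  exact Submodule.sum_mem _ fun S _ => Submodule.smul_mem _ _ (ιMulti_single_mem _)

/-- With `proj_of_mem_koszulPiece`, this identifies the spanning-set description of the internal
degree on ⋀^t with `extGrading` for s = t * c. -/
theorem mem_koszulPiece {c t j : ℕ} {x : ExteriorAlgebra R (Fin n → R)}
    (hx : x ∈ ⋀[R]^t (Fin n → R)) (hj : (extGrading 𝒜 n (t * c)).proj j x = x) :
    x ∈ koszulPiece 𝒜 (fun _ : Fin n => c) t j := by
  rw [extGrading_proj] at hj
  split_ifs at hj with h
  · obtain ⟨r, v, rfl⟩ := exists_sum_ιMulti hx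
    rw [← hj, extGrading_proj_sum]
    refine Submodule.sum_mem _ fun S _ => Submodule.subset_span
      ⟨j - t * c, _, v S, proj_mem _ _, ?_, rfl⟩
    simp only [Finset.sum_const, Finset.card_univ, Fintype.card_fin, smul_eq_mul]
    omega
  · rw [← hj]
    exact Submodule.zero_mem _

theorem proj_of_mem_koszulPiece {c t j : ℕ} {x : ExteriorAlgebra R (Fin n → R)}
    (hx : x ∈ koszulPiece 𝒜 (fun _ : Fin n => c) t j) :
    (extGrading 𝒜 n (t * c)).proj j x = x := by
  induction hx using Submodule.span_induction with
  | mem x hx =>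
    obtain ⟨p, r, v, hr, hp, rfl⟩ := hx
    simp only [Finset.sum_const, Finset.card_univ, Fintype.card_fin, smul_eq_mul] at hp
    subst hp
    rw [extGrading_proj, if_pos (Nat.le_add_left _ _), Nat.add_sub_cancel,
      ModuleGrading.proj_smul_mem _ hr, if_pos le_rfl, Nat.sub_self, extGrading_proj_ιMulti]
  | zero => exact map_zero _
  | add x y _ _ hx hy => rw [map_add, hx, hy]
  | smul k x _ hx =>
    have hk : algebraMap K R k ∈ 𝒜 0 := SetLike.algebraMap_mem_graded 𝒜 k
    rw [← algebraMap_smul R k x, ModuleGrading.proj_smul_mem _ hk, if_pos (Nat.zero_le _),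
      Nat.sub_zero, hx]

end Exterior

/-! ### The induction on the homological degree -/

section Main

variable {K : Type w} {R : Type u} [Field K] [CommRing R] [Algebra K R]
  {𝒜 : ℕ → Submodule K R} [GradedAlgebra 𝒜] {n : ℕ} {c : ℕ} {u : Fin n → R}

variable (𝒜) in
/-- The Koszul cycles of homological degree `t` and internal degree at least `t * (c + 1)`. -/
noncomputable def truncCycles (u : Fin n → R) (t : ℕ) :
    Submodule R (ExteriorAlgebra R (Fin n → R)) :=
  cycles u t ⊓ (extGrading 𝒜 n 0).trunc t

/-- Internal degree t * c + N on ⋀^t means coefficient degree N, which does not involve c; so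
internal degree t(c+1) is coefficient degree t. -/
theorem mem_trunc_iff {t N : ℕ} {x : ExteriorAlgebra R (Fin n → R)} :
    x ∈ (extGrading 𝒜 n (t * c)).trunc (t * c + N) ↔ x ∈ (extGrading 𝒜 n 0).trunc N := by
  refine ⟨fun h j hj => ?_, fun h j hj => ?_⟩
  · have := h (t * c + j) (by omega)
    rwa [extGrading_proj, if_pos (Nat.le_add_right _ _), Nat.add_sub_cancel_left] at this
  · rw [extGrading_proj]
    split_ifs
    · exact h _ (by omega)
    · rfl

theorem homogeneous_extGrading {s : ℕ} {N : Submodule R (ExteriorAlgebra R (Fin n → R))}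
    (h : (extGrading 𝒜 n 0).Homogeneous N) : (extGrading 𝒜 n s).Homogeneous N := fun i x hx => by
  rw [extGrading_proj]
  split_ifs
  · exact h _ x hx
  · exact N.zero_mem

theorem koszulDifferential_proj (hu : ∀ a, u a ∈ 𝒜 c) (i : ℕ)
    (x : ExteriorAlgebra R (Fin n → R)) :
    koszulDifferential u ((extGrading 𝒜 n 0).proj i x) =
      (extGrading 𝒜 n 0).proj (c + i) (koszulDifferential u x) := by
  rw [koszulDifferential_eq_sum, koszulDifferential_eq_sum, map_sum]
  refine Finset.sum_congr rfl fun a _ => ?_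
  rw [ModuleGrading.proj_smul_mem _ (hu a), if_pos (Nat.le_add_right _ _), Nat.add_sub_cancel_left,
    isHomogeneousMap_extContract]

theorem homogeneous_cycles (hu : ∀ a, u a ∈ 𝒜 c) (t : ℕ) :
    (extGrading 𝒜 n 0).Homogeneous (cycles u t) := fun i x hx =>
  ⟨extGrading_proj_mem i hx.1, by
    rw [SetLike.mem_coe, LinearMap.mem_ker, koszulDifferential_proj hu,
      LinearMap.mem_ker.mp hx.2, map_zero]⟩

theorem homogeneous_truncCycles (hu : ∀ a, u a ∈ 𝒜 c) (t s : ℕ) :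
    (extGrading 𝒜 n s).Homogeneous (truncCycles 𝒜 u t) :=
  homogeneous_extGrading fun i x hx => ⟨homogeneous_cycles hu t i x hx.1,
    ModuleGrading.homogeneous_trunc _ _ i x hx.2⟩

/-- The grading by internal degree of the truncated cycles. -/
noncomputable def truncCyclesGrading (hu : ∀ a, u a ∈ 𝒜 c) (t : ℕ) :
    ModuleGrading 𝒜 (truncCycles 𝒜 u t) :=
  (extGrading 𝒜 n (t * c)).sub _ (homogeneous_truncCycles hu t _)

theorem truncCyclesGrading_proj_eq_zero (hu : ∀ a, u a ∈ 𝒜 c) {t : ℕ} (x : truncCycles 𝒜 u t) :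
    ∀ j < t * (c + 1), (truncCyclesGrading hu t).proj j x = 0 := fun j hj =>
  Subtype.ext (mem_trunc_iff.mpr x.2.2 j (by rwa [mul_add_one] at hj))

theorem extContract_mem_cycles {t : ℕ} {z : ExteriorAlgebra R (Fin n → R)}
    (hz : z ∈ cycles u (t + 1)) (a : Fin n) : extContract R a z ∈ cycles u t :=
  ⟨extContract_mem a hz.1, by
    rw [SetLike.mem_coe, LinearMap.mem_ker, koszulDifferential_extContract,
      LinearMap.mem_ker.mp hz.2, map_zero, neg_zero]⟩

theorem extContract_mem_trunc {N : ℕ} {z : ExteriorAlgebra R (Fin n → R)}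
    (hz : z ∈ (extGrading 𝒜 n 0).trunc N) (a : Fin n) :
    extContract R a z ∈ (extGrading 𝒜 n 0).trunc N := fun j hj => by
  rw [← isHomogeneousMap_extContract, hz j hj, map_zero]

theorem extGen_mul_mem_trunc {N : ℕ} {z : ExteriorAlgebra R (Fin n → R)}
    (hz : z ∈ (extGrading 𝒜 n 0).trunc N) (a : Fin n) :
    extGen R a * z ∈ (extGrading 𝒜 n 0).trunc N := fun j hj => by
  have := isHomogeneousMap_extGen_mul (𝒜 := 𝒜) a j z
  rw [hz j hj, map_zero] at this
  exact this.symm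

theorem extContract_mem_truncCycles {t : ℕ} {z : ExteriorAlgebra R (Fin n → R)}
    (hz : z ∈ truncCycles 𝒜 u (t + 1)) (a : Fin n) :
    extContract R a z ∈ truncCycles 𝒜 u t :=
  ⟨extContract_mem_cycles hz.1 a,
    fun j hj => extContract_mem_trunc hz.2 a j (hj.trans (Nat.lt_succ_self t))⟩

/-- The contractions of a cycle, as a family of cycles. -/
noncomputable def contractions {t : ℕ} (z : truncCycles 𝒜 u (t + 1)) :
    Fin n → truncCycles 𝒜 u t :=
  fun a => ⟨extContract R a z, extContract_mem_truncCycles z.2 a⟩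

/-- The sum Σ u_a ∂_a z is the Koszul differential of z. -/
theorem relationMap_contractions {t : ℕ} (z : truncCycles 𝒜 u (t + 1)) :
    relationMap u _ (contractions z) = 0 := by
  apply Subtype.ext
  rw [relationMap_apply, Submodule.coe_sum]
  exact (koszulDifferential_eq_sum u z).symm.trans z.2.1.2

/-- Contraction keeps the coefficient degree, which for z is at least t + 1: one more than
membership in the truncated cycles of homological degree t requires. `mem_span_of_relation` needs
this gain. -/
theorem contractions_mem_trunc (hu : ∀ a, u a ∈ 𝒜 c) {t : ℕ} (z : truncCycles 𝒜 u (t + 1))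
    (a : Fin n) : contractions z a ∈ (truncCyclesGrading hu t).trunc (t * (c + 1) + 1) :=
  fun j hj => Subtype.ext (mem_trunc_iff (N := t + 1).mpr (extContract_mem_trunc z.2.2 a) j (by
    rw [mul_add_one] at hj
    omega))

/-- On cycles z_a the differential of Σ e_a ∧ z_a is Σ u_a z_a, so a relation among cycles produces
a cycle. -/
theorem sum_extGen_mul_mem_truncCycles {t : ℕ} {z : Fin n → ExteriorAlgebra R (Fin n → R)}
    (hz : ∀ a, z a ∈ cycles u t) (hz0 : ∑ a, u a • z a = 0)
    (hz' : ∀ a, z a ∈ (extGrading 𝒜 n 0).trunc (t + 1)) :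
    ∑ a, extGen R a * z a ∈ truncCycles 𝒜 u (t + 1) := by
  refine ⟨⟨?_, ?_⟩, Submodule.sum_mem _ fun a _ => extGen_mul_mem_trunc (hz' a) a⟩
  · refine Submodule.sum_mem _ fun a _ => ?_
    rw [ExteriorAlgebra.exteriorPower, pow_succ']
    exact Submodule.mul_mem_mul ⟨_, rfl⟩ (hz a).1
  · rw [SetLike.mem_coe, LinearMap.mem_ker, map_sum, ← hz0]
    refine Finset.sum_congr rfl fun a _ => ?_
    rw [extGen, koszulDifferential_ι_mul, koszulForm_single, LinearMap.mem_ker.mp (hz a).2,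
      mul_zero, sub_zero]

/-- If `t + 1` is invertible, the truncated cycles of homological degree `t + 1` are a direct
summand of a module of relations on the truncated cycles of homological degree `t`. -/
theorem regLE_truncCycles_succ [Nontrivial R] (hR : IsStandardGraded 𝒜)
    (hm : ∀ k, RegLE 𝒜 k 1 (maxIdeal 𝒜) ((ModuleGrading.self 𝒜).sub _ (homogeneous_maxIdeal 𝒜)))
    (hu : ∀ a, u a ∈ 𝒜 c) (hrange : LinearMap.range (koszulForm u) = maxIdeal 𝒜 ^ c) {t : ℕ}
    (ht : ((t + 1 : ℕ) : K) ≠ 0)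
    (h : ∀ k, RegLE 𝒜 k (t * (c + 1)) _ (truncCyclesGrading hu t)) (k : ℕ) :
    RegLE 𝒜 k ((t + 1) * (c + 1)) _ (truncCyclesGrading hu (t + 1)) := by
  have hrel := RegLE.relations hR hm hu hrange h (truncCyclesGrading_proj_eq_zero hu) k
  have hd : t * (c + 1) + c + 1 = (t + 1) * (c + 1) := by ring
  -- The extra shift by c changes the internal degree on ⋀^t to that on ⋀^{t+1}, as t * c + c = (t +
  -- 1) * c.
  have hcomp : ∀ (i : ℕ) (z : Fin n → truncCycles 𝒜 u t) (a : Fin n),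
      ((((truncCyclesGrading hu t).pi fun _ => c).proj i z a : truncCycles 𝒜 u t) :
        ExteriorAlgebra R (Fin n → R)) = (extGrading 𝒜 n ((t + 1) * c)).proj i (z a) := by
    intro i z a
    rw [ModuleGrading.pi_proj_apply, extGrading_proj, add_one_mul]
    split_ifs with h1 h2 h2
    · rw [truncCyclesGrading, ModuleGrading.coe_sub_proj, extGrading_proj, if_pos (by omega)]
      congr 2
      omega
    · rw [truncCyclesGrading, ModuleGrading.coe_sub_proj, extGrading_proj, if_neg (by omega)]
    · omega
    · rfl
  have htr : ∀ z : truncCycles 𝒜 u (t + 1), ∀ j < t * (c + 1) + c + 1,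
      ((truncCyclesGrading hu t).pi fun _ => c).proj j (contractions z) = 0 := fun z j hj => by
    ext a : 1
    apply Subtype.ext
    rw [hcomp]
    exact mem_trunc_iff (N := t + 1).mpr (extContract_mem_trunc z.2.2 a) j (by
      rw [mul_add_one] at hj
      rw [add_one_mul]
      omega)
  have hback : ∀ z : Fin n → truncCycles 𝒜 u t, relationMap u _ z = 0 →
      (∀ j < t * (c + 1) + c + 1, ((truncCyclesGrading hu t).pi fun _ => c).proj j z = 0) →
      ∑ a, extGen R a * (z a : ExteriorAlgebra R (Fin n → R)) ∈ truncCycles 𝒜 u (t + 1) := by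
    intro z hz hz'
    refine sum_extGen_mul_mem_truncCycles (fun a => (z a).2.1) ?_ fun a => ?_
    · rw [relationMap_apply] at hz
      simpa using congrArg Subtype.val hz
    · refine mem_trunc_iff (t := t + 1) (c := c).mp fun j hj => ?_
      rw [← hcomp, hz' j (by
        rw [mul_add_one]
        rw [add_one_mul] at hj
        omega)]
      rfl
  have hinv : algebraMap K R ((t + 1 : ℕ) : K)⁻¹ * ((t + 1 : ℕ) : R) = 1 := by
    rw [← map_natCast (algebraMap K R), ← map_mul, inv_mul_cancel₀ ht, map_one]
  rw [hd] at hrel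
  let f : truncCycles 𝒜 u (t + 1) →ₗ[R] (Fin n → truncCycles 𝒜 u t) :=
    { toFun := contractions
      map_add' := fun x y => funext fun a => Subtype.ext (map_add (extContract R a) _ _)
      map_smul' := fun r x => funext fun a => Subtype.ext (map_smul (extContract R a) _ _) }
  let r : (Fin n → truncCycles 𝒜 u t) →ₗ[R] ExteriorAlgebra R (Fin n → R) :=
    algebraMap K R ((t + 1 : ℕ) : K)⁻¹ • ∑ a, LinearMap.mulLeft R (extGen R a) ∘ₗ
      (truncCycles 𝒜 u t).subtype ∘ₗ LinearMap.proj a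
  have hr : ∀ z, r z = algebraMap K R ((t + 1 : ℕ) : K)⁻¹ •
      ∑ a, extGen R a * (z a : ExteriorAlgebra R (Fin n → R)) := fun z => by
    simp [r]
  refine hrel.retract_submodule (f := f) (r := r) (fun i z => ?_) (fun i z => ?_)
    (fun z => mem_relationModule.mpr ⟨relationMap_contractions z, fun j hj => htr z j (hj.trans_eq hd.symm)⟩)
    (fun z hz => ?_) (fun z => ?_)
  · refine funext fun a => Subtype.ext ?_
    refine Eq.trans ?_ (hcomp i (contractions z) a).symm
    change extContract R a ((extGrading 𝒜 n ((t + 1) * c)).proj i z) =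
      (extGrading 𝒜 n ((t + 1) * c)).proj i (extContract R a z)
    exact isHomogeneousMap_extGrading (isHomogeneousMap_extContract a) _ _ _
  · rw [hr, hr, ModuleGrading.proj_smul_mem _ (SetLike.algebraMap_mem_graded 𝒜 _),
      if_pos (Nat.zero_le _), Nat.sub_zero, map_sum]
    congr 1
    refine Finset.sum_congr rfl fun a _ => ?_
    rw [hcomp]
    exact isHomogeneousMap_extGrading (isHomogeneousMap_extGen_mul a) _ _ _
  · obtain ⟨hz1, hz2⟩ := mem_relationModule.mp hz
    rw [hr]
    exact Submodule.smul_mem _ _ (hback z hz1 fun j hj => hz2 j (hj.trans_eq hd))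
  · have hfz : ∀ a, (f z a : ExteriorAlgebra R (Fin n → R)) =
        extContract R a (z : ExteriorAlgebra R (Fin n → R)) := fun a => rfl
    simp only [hr, hfz]
    rw [sum_extGen_mul_extContract z.2.1.1, smul_smul, hinv, one_smul]

theorem ι_mem_cycles {w : Fin n → R} (hw : koszulForm u w = 0) :
    ExteriorAlgebra.ι R w ∈ cycles u 1 := by
  refine ⟨?_, ?_⟩
  · rw [SetLike.mem_coe, ExteriorAlgebra.exteriorPower, pow_one]
    exact ⟨w, rfl⟩
  · have := koszulDifferential_ι_mul u w 1
    rw [mul_one, hw, zero_smul, zero_sub] at this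
    rw [SetLike.mem_coe, LinearMap.mem_ker, this, koszulDifferential_eq_sum]
    simp [extContract_one]

theorem exists_of_mem_cycles_one {z : ExteriorAlgebra R (Fin n → R)} (hz : z ∈ cycles u 1) :
    ∃ w, koszulForm u w = 0 ∧ ExteriorAlgebra.ι R w = z := by
  obtain ⟨h1, h2⟩ := hz
  rw [SetLike.mem_coe, ExteriorAlgebra.exteriorPower, pow_one] at h1
  obtain ⟨w, rfl⟩ := h1
  refine ⟨w, ?_, rfl⟩
  have h3 : koszulDifferential u (ExteriorAlgebra.ι R w) = algebraMap R _ (koszulForm u w) :=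
    CliffordAlgebra.contractLeft_ι (Q := (0 : QuadraticForm R (Fin n → R))) _ w
  rw [SetLike.mem_coe, LinearMap.mem_ker, h3] at h2
  exact (ExteriorAlgebra.algebraMap_eq_zero_iff _ _).mp h2

theorem truncCycles_zero : truncCycles 𝒜 u 0 = cyclesPow u 0 := by
  refine le_antisymm (fun x hx => ?_) fun x hx => ⟨cyclesPow_le u 0 hx, fun j hj => ?_⟩
  · have := hx.1.1
    rwa [SetLike.mem_coe, ExteriorAlgebra.exteriorPower, pow_zero] at this
  · exact absurd hj (Nat.not_lt_zero j)

/-- For ≤, the contractions of z are written as Σ_b w_b(a) y_b, and Euler's formula turns this into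
(t+1) z = Σ_b w_b ∧ y_b. -/
theorem truncCycles_succ [Nontrivial R] (hR : IsStandardGraded 𝒜)
    (hu : ∀ a, u a ∈ 𝒜 c) (hrange : LinearMap.range (koszulForm u) = maxIdeal 𝒜 ^ c)
    (hker : LinearMap.ker (koszulForm u) ≤ maxIdeal 𝒜 • (⊤ : Submodule R (Fin n → R))) {t : ℕ}
    (ht : ((t + 1 : ℕ) : K) ≠ 0)
    (h : RegLE 𝒜 2 (t * (c + 1)) _ (truncCyclesGrading hu t))
    (hpow : truncCycles 𝒜 u t = cyclesPow u t) :
    truncCycles 𝒜 u (t + 1) = cyclesPow u (t + 1) := by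
  refine le_antisymm (fun z hz => ?_) fun z hz => ⟨cyclesPow_le u _ hz, ?_⟩
  · obtain ⟨m, w, y, hw, hy⟩ := mem_span_of_relation hR hu hrange h
      (truncCyclesGrading_proj_eq_zero hu) (relationMap_contractions ⟨z, hz⟩)
      (contractions_mem_trunc hu ⟨z, hz⟩)
    have hy' : ∀ a, extContract R a z =
        ∑ b, w b a • (y b : ExteriorAlgebra R (Fin n → R)) := fun a => by
      simpa [contractions] using congrArg Subtype.val (hy a)
    have h1 : ((t + 1 : ℕ) : R) • z =
        ∑ b, ExteriorAlgebra.ι R (w b) * (y b : ExteriorAlgebra R (Fin n → R)) := by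
      rw [← sum_extGen_mul_extContract hz.1.1]
      simp only [hy', Finset.mul_sum, ι_eq_sum, Finset.sum_mul]
      rw [Finset.sum_comm]
      simp only [mul_smul_comm, smul_mul_assoc]
    have h2 : ((t + 1 : ℕ) : R) • z ∈ cyclesPow u (t + 1) := by
      rw [h1, cyclesPow, pow_succ']
      exact Submodule.sum_mem _ fun b _ =>
        Submodule.mul_mem_mul (ι_mem_cycles (hw b)) (hpow.le (y b).2)
    have h3 := Submodule.smul_mem _ (algebraMap K R ((t + 1 : ℕ) : K)⁻¹) h2
    rwa [smul_smul, ← map_natCast (algebraMap K R), ← map_mul, inv_mul_cancel₀ ht, map_one,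
      one_smul] at h3
  · rw [cyclesPow, pow_succ'] at hz
    refine Submodule.mul_induction_on hz ?_ fun x y hx hy => Submodule.add_mem _ hx hy
    intro z hz y hy
    obtain ⟨w, hw, rfl⟩ := exists_of_mem_cycles_one hz
    have hy' : y ∈ truncCycles 𝒜 u t := hpow.ge hy
    rw [ι_eq_sum, Finset.sum_mul]
    refine Submodule.sum_mem _ fun a _ => ?_
    rw [smul_mul_assoc]
    -- Minimality gives Z_1 ⊆ 𝔪F, so each factor from Z_1 raises the coefficient degree by at least
    -- one.
    exact ModuleGrading.smul_mem_trunc_succ _ (mem_maxIdeal_smul_top.mp (hker hw) a)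
      (extGen_mul_mem_trunc hy'.2 a)

theorem regLE_truncCycles_zero (hu : ∀ a, u a ∈ 𝒜 c) (k : ℕ) :
    RegLE 𝒜 k (0 * (c + 1)) _ (truncCyclesGrading hu 0) := by
  let L : (Unit → R) →ₗ[R] ExteriorAlgebra R (Fin n → R) :=
    Fintype.linearCombination R fun _ => 1
  have hLx : ∀ x, L x = algebraMap R _ (x ()) := fun x => by
    simp [L, Fintype.linearCombination_apply, Algebra.algebraMap_eq_smul_one]
  -- The shift is written 0 * c to match `truncCyclesGrading` at t = 0.
  have hL : IsHomogeneousMap (ModuleGrading.free 𝒜 fun _ : Unit => 0 * c)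
      (extGrading 𝒜 n (0 * c)) L := IsHomogeneousMap.linearCombination fun _ => by
    rw [extGrading_proj, if_pos le_rfl, Nat.sub_self, extGrading_proj_one]
  have hmem : ∀ x, L x ∈ truncCycles 𝒜 u 0 := fun x => by
    rw [truncCycles_zero, cyclesPow, pow_zero, hLx]
    exact Submodule.mem_one.mpr ⟨_, rfl⟩
  let e : (Unit → R) ≃ₗ[R] truncCycles 𝒜 u 0 := LinearEquiv.ofBijective (L.codRestrict _ hmem)
    ⟨fun x y hxy => by
      have h1 : L x = L y := congrArg Subtype.val hxy
      rw [hLx, hLx, ExteriorAlgebra.algebraMap_inj] at h1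
      exact funext fun _ => h1, fun y => by
      have hy := y.2
      have h1 : (y : ExteriorAlgebra R (Fin n → R)) ∈ cyclesPow u 0 :=
        (truncCycles_zero (𝒜 := 𝒜) (u := u)).le y.2
      rw [cyclesPow, pow_zero] at h1
      obtain ⟨r, hr⟩ := Submodule.mem_one.mp h1
      exact ⟨fun _ => r, Subtype.ext ((hLx _).trans hr)⟩⟩
  exact (RegLE.free (𝒜 := 𝒜) (s := fun _ : Unit => 0 * c) (d := 0 * (c + 1)) (fun _ => by simp)
    k).of_equiv e (hL.codRestrict _ _ _)

/-- The two statements are carried together: the equality for t + 1 uses the equality and the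
regularity bound for t. -/
theorem truncCycles_eq_cyclesPow [Nontrivial R] (hR : IsStandardGraded 𝒜)
    (hm : ∀ k, RegLE 𝒜 k 1 (maxIdeal 𝒜) ((ModuleGrading.self 𝒜).sub _ (homogeneous_maxIdeal 𝒜)))
    (hu : ∀ a, u a ∈ 𝒜 c) (hrange : LinearMap.range (koszulForm u) = maxIdeal 𝒜 ^ c)
    (hker : LinearMap.ker (koszulForm u) ≤ maxIdeal 𝒜 • (⊤ : Submodule R (Fin n → R))) {t : ℕ}
    (ht : ∀ s < t, ((s + 1 : ℕ) : K) ≠ 0) :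
    truncCycles 𝒜 u t = cyclesPow u t ∧
      ∀ k, RegLE 𝒜 k (t * (c + 1)) _ (truncCyclesGrading hu t) := by
  induction t with
  | zero => exact ⟨truncCycles_zero, regLE_truncCycles_zero hu⟩
  | succ t ih =>
    obtain ⟨h1, h2⟩ := ih fun s hs => ht s (hs.trans (Nat.lt_succ_self t))
    exact ⟨truncCycles_succ hR hu hrange hker (ht t (Nat.lt_succ_self t)) (h2 2) h1,
      regLE_truncCycles_succ hR hm hu hrange (ht t (Nat.lt_succ_self t)) h2⟩

end Main

end KoszulCycles

/-! ### Conclusion -/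

theorem theorem5p2 {K R : Type*} [Field K] [CommRing R] [Nontrivial R] [Algebra K R]
    (𝒜 : ℕ → Submodule K R) [GradedAlgebra 𝒜]
    (hR : KoszulCycles.IsStandardGraded 𝒜) (hKoszul : KoszulCycles.IsKoszul 𝒜)
    (c t : ℕ) (hchar : ringChar K = 0 ∨ t < ringChar K)
    {n : ℕ} (deg : Fin n → ℕ) (u : Fin n → R)
    (hu : KoszulCycles.IsMinimalGenerators 𝒜 (KoszulCycles.maxIdeal 𝒜 ^ c) deg u) :
    (∀ j : ℕ, t * (c + 1) ≤ j → KoszulCycles.quotientPiece 𝒜 deg u t j = ⊥) ∧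
    KoszulCycles.HasLinearResolution 𝒜
      (KoszulCycles.inducedGrading 𝒜 deg t (KoszulCycles.cyclesPow u t)) (t * (c + 1)) := by
  open KoszulCycles in
  obtain rfl : deg = fun _ => c := funext (hu.deg_eq hR)
  have hdeg : ∀ a, u a ∈ 𝒜 c := hu.mem
  -- The integers 1, …, t divided by in the successive Euler formulas are nonzero in K.
  have hinv : ∀ s < t, ((s + 1 : ℕ) : K) ≠ 0 := fun s hs h0 => by
    rw [ringChar.spec] at h0
    obtain h | h := hchar
    · rw [h, zero_dvd_iff] at h0
      exact Nat.succ_ne_zero s h0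
    · exact absurd (Nat.le_of_dvd (Nat.succ_pos s) h0) (by omega)
  obtain ⟨hpow, hreg⟩ := truncCycles_eq_cyclesPow hR (hKoszul.regLE_maxIdeal hR) hdeg hu.range_eq
    hu.ker_le hinv
  refine ⟨fun j hj => ?_, ?_⟩
  · rw [eq_bot_iff]
    rintro _ ⟨x, hx, rfl⟩
    refine (Submodule.Quotient.mk_eq_zero _).mpr ?_
    have hx' := proj_of_mem_koszulPiece (x := (x : ExteriorAlgebra R (Fin n → R))) hx
    change (x : ExteriorAlgebra R (Fin n → R)) ∈ cyclesPow u t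
    rw [← hpow]
    exact ⟨x.2, mem_trunc_iff (t := t) (c := c).mp
      (ModuleGrading.mem_trunc_of_homogeneous _ hx' (by rwa [← mul_add_one]))⟩
  · rw [← hpow]
    exact hasLinearResolution_of_regLE hR hreg (truncCyclesGrading_proj_eq_zero hdeg)
      fun x hx => mem_koszulPiece x.2.1.1 (congrArg Subtype.val hx)
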